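/- Let $Q$ be a smooth manifold of dimension $n$ with a smooth Riemannian metric $\mathscr G$ and Levi-Civita connection $\nabla$. Let $F^0:TQ\to T^*Q$ be a smooth fibre-preserving map (external force), let $f^1,\dots,f^m$ be smooth one-forms on $Q$ (control forces), and put $Y^0=\sharp F^0$, $Y^a=\sharp f^a$, where $\sharp$ is the inverse of $\flat(v)=\mathscr G(v,\cdot)$. Consider the mechanical control system $$\nabla_{\dot q}\dot q=Y^0(\dot q)+\sum_{a=1}^m u_aY^a(q),\qquad u\in\mathbb R^m ,$$ that is, the vector field $\Gamma=G+\sum_a u_a(Y^a)^V$ on $TQ$, where $G$ is the vector field on $TQ$ of $\nabla_{\dot q}\dot q=Y^0(\dot q)$ and $(Y^a)^V_{v_q}=\frac{d}{dt}\big|_{t=0}(v_q+tY^a(q))$ is the vertical lift. Let $\mathscr F_q=\operatorname{span}\{Y^1(q),\dots,Y^m(q)\}$. Let $\mathscr D$ be a smooth distribution on $Q$ of constant rank $n-m$ (locally the common kernel of $m$ pointwise linearly independent smooth one-forms), $X$ a smooth vector field, $\mathscr A_q=X(q)+\mathscr D_q$ and $\mathscr A=\bigcup_q\mathscr A_q\subseteq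 TQ$. Suppose that $\mathscr A$ and $\mathscr F$ are transversal: $T_qQ=\mathscr A_q+\mathscr F_q$ and $\dim T_qQ=\dim\mathscr A_q+\dim\mathscr F_q$ for all $q\in Q$, the dimension of an affine subspace being that of its direction. A smooth function $\hat u:\mathscr A\to\mathbb R^m$ (equivalently, one with a smooth extension to $TQ$) is said to make $\mathscr A$ a virtual affine nonholonomic constraint if, for every smooth extension $u:TQ\to\mathbb R^m$ of $\hat u$, the set $\mathscr A$ is invariant under the flow of the closed-loop vector field $\Gamma_u(v)=G(v)+\sum_a u_a(v)(Y^a)^V_v$ on $TQ$, i.e. every integral curve of $\Gamma_u$ on an open interval that meets $\mathscr A$ stays in $\mathscr A$. Then there is a unique $\hat u:\mathscr A\to\mathbb R^m$ that makes $\mathscr A$ a virtual affine nonholonomic constraint. Moreover: 1. If $\hat u':\mathscr A\to\mathbb R^m$ is any function, without regularity assumption, such that through every $v\in\mathscr A$ there is an integral curve on some $(-\varepsilon,\varepsilon)$ of the closed-loop system with control $\hat u'$ that stays in $\mathscr A$, then $\hat u'=\hat u$. 2. If $\mathscr D$ is on an open set $U\subseteq Q$ the common kernel of pointwise linearly independent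 smooth one-forms $\mu^1,\dots,\mu^m$, and $\phi^b(v_q)=\mu^b(q)(v_q-X(q))$, then the matrix $P(q)=\big(\mu^b(q)(Y^a(q))\big)_{b,a}$ is invertible for all $q\in U$, and $\tau=\hat u(v_q)$ solves $P(q)\tau=b(v_q)$ with $b^b(v_q)=-d\phi^b(G(v_q))$ for all $v_q\in\mathscr A$ with $q\in U$. 3. For every smooth extension $u$ of $\hat u$ to $TQ$, the vector field $\Gamma_u$ on $TQ$ is smooth and is tangent to $\mathscr A$ at every point of $\mathscr A$, and its integral curves on any open set of times are exactly the velocity curves $\dot q$ of the solutions $q$ of $\nabla_{\dot q}\dot q=Y^0(\dot q)+\sum_a u_a(\dot q)Y^a(q)$. -/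

import Mathlib

open scoped Manifold ContDiff Topology Pointwise
open Bundle Set

noncomputable section

/-! ### Riemannian geometry in the charts of a manifold `Q` modelled on `E` -/

section Riemannian

variable {E : Type*} [NormedAddCommGroup E] [NormedSpace ℝ E]
  {Q : Type*} [TopologicalSpace Q] [ChartedSpace E Q]

/-- A one-form on `Q` (no regularity), i.e. a family of covectors. -/
abbrev OneForm (E : Type*) [NormedAddCommGroup E] [NormedSpace ℝ E]
    (Q : Type*) [TopologicalSpace Q] [ChartedSpace E Q] : Type _ :=
  ∀ q : Q, TangentSpace 𝓘(ℝ, E) q →L[ℝ] ℝ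

/-- The one-form `α` is smooth on the set `U`, as a section of the cotangent bundle. -/
def OneForm.SmoothOn [IsManifold 𝓘(ℝ, E) ∞ Q] (α : OneForm E Q) (U : Set Q) : Prop :=
  ContMDiffOn 𝓘(ℝ, E) (𝓘(ℝ, E).prod 𝓘(ℝ, E →L[ℝ] ℝ)) ∞
    (fun q : Q ↦ TotalSpace.mk' (E →L[ℝ] ℝ) (E := fun q : Q ↦ TangentSpace 𝓘(ℝ, E) q →L[ℝ] ℝ)
      q (α q)) U

/-- A smooth Riemannian metric on `Q`. -/
abbrev SmoothMetric (E : Type*) [NormedAddCommGroup E] [NormedSpace ℝ E]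
    (Q : Type*) [TopologicalSpace Q] [ChartedSpace E Q] [IsManifold 𝓘(ℝ, E) ∞ Q] : Type _ :=
  ContMDiffRiemannianMetric 𝓘(ℝ, E) ∞ E (TangentSpace 𝓘(ℝ, E) : Q → Type _)

theorem finrank_cotangent [FiniteDimensional ℝ E] (q : Q) :
    Module.finrank ℝ (TangentSpace 𝓘(ℝ, E) q) =
      Module.finrank ℝ (TangentSpace 𝓘(ℝ, E) q →L[ℝ] ℝ) := by
  change Module.finrank ℝ E = Module.finrank ℝ (E →L[ℝ] ℝ)
  rw [← Subspace.dual_finrank_eq (K := ℝ) (V := E)]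
  exact (LinearMap.toContinuousLinearMap (𝕜 := ℝ) (E := E) (F' := ℝ)).finrank_eq

/-- For a field `h` of bilinear forms on `E`, the Christoffel symbols of the first kind at `x`: the
covector `c ↦ ½ (∂_a h(b, c) + ∂_b h(a, c) - ∂_c h(a, b))`. -/
def christoffelForm (h : E → E →L[ℝ] E →L[ℝ] ℝ) (x : E) (a b : E) : E →L[ℝ] ℝ :=
  (1 / 2 : ℝ) • (fderiv ℝ h x a b + fderiv ℝ h x b a - ((fderiv ℝ h x).flip a).flip b)

namespace SmoothMetric

variable [IsManifold 𝓘(ℝ, E) ∞ Q] (g : SmoothMetric E Q)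

theorem flat_injective (q : Q) : Function.Injective (g.inner q).toLinearMap := by
  rw [← LinearMap.ker_eq_bot, LinearMap.ker_eq_bot']
  intro v hv
  by_contra hne
  have h := g.pos q v hne
  have h0 : g.inner q v v = 0 := by
    have : g.inner q v = 0 := hv
    rw [this]; rfl
  exact absurd h (by rw [h0]; exact lt_irrefl 0)

variable [FiniteDimensional ℝ E]

/-- The musical isomorphism `♭ : T_qQ ≃ T*_qQ`, `♭(v)(w) = g(v, w)`. -/
def flat (q : Q) : TangentSpace 𝓘(ℝ, E) q ≃ₗ[ℝ] (TangentSpace 𝓘(ℝ, E) q →L[ℝ] ℝ) :=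
  haveI : FiniteDimensional ℝ (TangentSpace 𝓘(ℝ, E) q) := inferInstanceAs (FiniteDimensional ℝ E)
  haveI : FiniteDimensional ℝ (TangentSpace 𝓘(ℝ, E) q →L[ℝ] ℝ) :=
    inferInstanceAs (FiniteDimensional ℝ (E →L[ℝ] ℝ))
  LinearMap.linearEquivOfInjective (g.inner q).toLinearMap (g.flat_injective q)
    (finrank_cotangent q)

/-- The inverse musical isomorphism `♯ : T*_qQ → T_qQ`. -/
def sharp (q : Q) (α : TangentSpace 𝓘(ℝ, E) q →L[ℝ] ℝ) : TangentSpace 𝓘(ℝ, E) q :=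
  (g.flat q).symm α

/-- The coordinate expression of the metric in the preferred chart `φ` at `q₀`:
`x ↦ ((a, b) ↦ g_{φ⁻¹(x)}(dφ⁻¹(x) a, dφ⁻¹(x) b))`. -/
def inChart (q₀ : Q) (x : E) : E →L[ℝ] E →L[ℝ] ℝ :=
  let A : E →L[ℝ] E := mfderiv 𝓘(ℝ, E) 𝓘(ℝ, E) (extChartAt 𝓘(ℝ, E) q₀).symm x
  let G : E →L[ℝ] E →L[ℝ] ℝ := g.inner ((extChartAt 𝓘(ℝ, E) q₀).symm x)
  G.bilinearComp A A

/-- The Christoffel symbols of the Levi-Civita connection of `g` in the preferred chart `φ` at `q`,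
evaluated at the point `q`: the vector `Γ(a, b)` with
`g(Γ(a, b), c) = ½ (∂_a g(b, c) + ∂_b g(a, c) - ∂_c g(a, b))` for all `c`. (The differential of
`φ` at `q` is the identification of `T_qQ` with `E` that Mathlib uses as the definition of
`T_qQ`.) -/
def christoffel (q : Q) (a b : TangentSpace 𝓘(ℝ, E) q) : TangentSpace 𝓘(ℝ, E) q :=
  g.sharp q (christoffelForm (E := E) (g.inChart q) (extChartAt 𝓘(ℝ, E) q q) a b)

end SmoothMetric

/-- The velocity `q̇(t) ∈ T_{q(t)}Q` of a curve in `Q`. -/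
def velocity (q : ℝ → Q) (t : ℝ) : TangentSpace 𝓘(ℝ, E) (q t) :=
  mfderiv 𝓘(ℝ, ℝ) 𝓘(ℝ, E) q t (1 : ℝ)

/-- The curve `q` is twice differentiable at `t` and `∇_{q̇} q̇ (t) = w`, where `∇` is the
Levi-Civita connection of `g`: in the preferred chart at `q(t)`, in which the curve reads `x`,
one has `w = ẍ + Γ(ẋ, ẋ)` at time `t`. -/
def HasCovariantAcceleration [IsManifold 𝓘(ℝ, E) ∞ Q] [FiniteDimensional ℝ E]
    (g : SmoothMetric E Q) (q : ℝ → Q) (t : ℝ) (w : TangentSpace 𝓘(ℝ, E) (q t)) : Prop :=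
  ∃ y : E, HasDerivAt (deriv (fun s ↦ extChartAt 𝓘(ℝ, E) (q t) (q s))) y t ∧
    w = (show TangentSpace 𝓘(ℝ, E) (q t) from y) +
      g.christoffel (q t) (velocity q t) (velocity q t)

/-- The vertical lift of `w ∈ T_qQ` to `T_{v_q}(TQ)`: the velocity at `t = 0` of `v_q + t w`. -/
def verticalLift (v : TangentBundle 𝓘(ℝ, E) Q) [IsManifold 𝓘(ℝ, E) 1 Q]
    (w : TangentSpace 𝓘(ℝ, E) v.proj) :
    TangentSpace 𝓘(ℝ, E).tangent v :=
  let c : ℝ → TangentBundle 𝓘(ℝ, E) Q := fun t ↦ ⟨v.proj, v.snd + t • w⟩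
  mfderiv 𝓘(ℝ, ℝ) 𝓘(ℝ, E).tangent c 0 (1 : ℝ)

/-- The geodesic vector field (spray) of the Levi-Civita connection on `TQ`. In the bundle chart of
`TQ` induced by the preferred chart at `q` it is `(v, -Γ(v, v))` at the point `v ∈ T_qQ`; Mathlib's
`T_v(TQ)` is `E × E`, identified through precisely that chart. -/
def geodesicField [IsManifold 𝓘(ℝ, E) ∞ Q] [FiniteDimensional ℝ E] (g : SmoothMetric E Q)
    (v : TangentBundle 𝓘(ℝ, E) Q) : TangentSpace 𝓘(ℝ, E).tangent v :=
  ((v.snd : E), (-(g.christoffel v.proj v.snd v.snd) : E))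

end Riemannian

/-! ### Mechanical control systems -/

/-- The data of a mechanical control system `∇_{q̇} q̇ = Y⁰(q̇) + ∑ u_a Y^a(q)` with `m` inputs:
a Riemannian metric, a smooth external force `F⁰ : TQ → T*Q` over `Q` and smooth control one-forms
`f^1, …, f^m`. -/
structure MechanicalControlSystem (E : Type*) [NormedAddCommGroup E] [NormedSpace ℝ E]
    (Q : Type*) [TopologicalSpace Q] [ChartedSpace E Q] [IsManifold 𝓘(ℝ, E) ∞ Q] (m : ℕ) where
  /-- the kinetic energy metric -/
  metric : SmoothMetric E Q
  /-- the external force `F⁰` -/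
  externalForce : ∀ v : TangentBundle 𝓘(ℝ, E) Q, TangentSpace 𝓘(ℝ, E) v.proj →L[ℝ] ℝ
  externalForce_smooth :
    ContMDiff 𝓘(ℝ, E).tangent (𝓘(ℝ, E).prod 𝓘(ℝ, E →L[ℝ] ℝ)) ∞
      (fun v : TangentBundle 𝓘(ℝ, E) Q ↦ TotalSpace.mk' (E →L[ℝ] ℝ)
        (E := fun q : Q ↦ TangentSpace 𝓘(ℝ, E) q →L[ℝ] ℝ) v.proj (externalForce v))
  /-- the control one-forms `f^a` -/
  controlForce : Fin m → OneForm E Q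
  controlForce_smooth : ∀ a, (controlForce a).SmoothOn univ

namespace MechanicalControlSystem

variable {E : Type*} [NormedAddCommGroup E] [NormedSpace ℝ E] [FiniteDimensional ℝ E]
  {Q : Type*} [TopologicalSpace Q] [ChartedSpace E Q] [IsManifold 𝓘(ℝ, E) ∞ Q] {m : ℕ}
  (S : MechanicalControlSystem E Q m)

/-- `Y⁰ = ♯ F⁰`. -/
def drift (v : TangentBundle 𝓘(ℝ, E) Q) : TangentSpace 𝓘(ℝ, E) v.proj :=
  S.metric.sharp v.proj (S.externalForce v)

/-- `Y^a = ♯ f^a`. -/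
def inputField (a : Fin m) (q : Q) : TangentSpace 𝓘(ℝ, E) q :=
  S.metric.sharp q (S.controlForce a q)

/-- The input distribution `ℱ`, generated by the `Y^a`. -/
def inputDistribution (q : Q) : Submodule ℝ (TangentSpace 𝓘(ℝ, E) q) :=
  Submodule.span ℝ (range fun a ↦ S.inputField a q)

/-- The vector field `G` on `TQ` of the unactuated system `∇_{q̇} q̇ = Y⁰(q̇)`. -/
def unactuatedField (v : TangentBundle 𝓘(ℝ, E) Q) : TangentSpace 𝓘(ℝ, E).tangent v :=
  geodesicField S.metric v + verticalLift v (S.drift v)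

/-- The controlled vector `Γ(v) = G(v) + ∑ u_a (Y^a)^V_v` at `v ∈ TQ` with control value `u`. -/
def controlledVector (v : TangentBundle 𝓘(ℝ, E) Q) (u : Fin m → ℝ) :
    TangentSpace 𝓘(ℝ, E).tangent v :=
  S.unactuatedField v + ∑ a, u a • verticalLift v (S.inputField a v.proj)

/-- The closed-loop vector field on `TQ` of a feedback `u : TQ → ℝ^m`. -/
def closedLoopField (u : TangentBundle 𝓘(ℝ, E) Q → Fin m → ℝ)
    (v : TangentBundle 𝓘(ℝ, E) Q) : TangentSpace 𝓘(ℝ, E).tangent v :=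
  S.controlledVector v (u v)

/-- On the set of times `J`, the curve `q` solves the closed-loop mechanical control system
`∇_{q̇} q̇ = Y⁰(q̇) + ∑ u_a(q̇) Y^a(q)`. -/
def IsTrajectoryOn (u : TangentBundle 𝓘(ℝ, E) Q → Fin m → ℝ) (q : ℝ → Q) (J : Set ℝ) : Prop :=
  ∀ t ∈ J, MDifferentiableAt 𝓘(ℝ, ℝ) 𝓘(ℝ, E) q t ∧
    HasCovariantAcceleration S.metric q t
      (S.drift ⟨q t, velocity q t⟩ +
        ∑ a, u ⟨q t, velocity q t⟩ a • S.inputField a (q t))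

end MechanicalControlSystem

/-! ### Affine distributions -/

/-- On `U`, the distribution `D` is the common kernel of the smooth one-forms `μ^1, …, μ^m`, which
are linearly independent at each point of `U`. -/
structure IsAnnihilatorOn {E : Type*} [NormedAddCommGroup E] [NormedSpace ℝ E]
    {Q : Type*} [TopologicalSpace Q] [ChartedSpace E Q] [IsManifold 𝓘(ℝ, E) ∞ Q] {m : ℕ}
    (D : ∀ q : Q, Submodule ℝ (TangentSpace 𝓘(ℝ, E) q)) (U : Set Q)
    (μ : Fin m → OneForm E Q) : Prop where
  smooth : ∀ b, (μ b).SmoothOn U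
  independent : ∀ q ∈ U, LinearIndependent ℝ fun b ↦ μ b q
  mem_iff : ∀ q ∈ U, ∀ v : TangentSpace 𝓘(ℝ, E) q, v ∈ D q ↔ ∀ b, μ b q v = 0

/-- A smooth affine distribution `𝒜 = X + 𝒟` on `Q`, where `X` is a smooth vector field and `𝒟` a
smooth distribution of constant rank `dim Q - m`, i.e. locally the null space of `m` independent
smooth one-forms. -/
structure AffineDistribution (E : Type*) [NormedAddCommGroup E] [NormedSpace ℝ E]
    (Q : Type*) [TopologicalSpace Q] [ChartedSpace E Q] [IsManifold 𝓘(ℝ, E) ∞ Q] (m : ℕ) where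
  /-- the vector field `X` -/
  X : ∀ q : Q, TangentSpace 𝓘(ℝ, E) q
  X_smooth : ContMDiff 𝓘(ℝ, E) 𝓘(ℝ, E).tangent ∞
    (fun q : Q ↦ (⟨q, X q⟩ : TangentBundle 𝓘(ℝ, E) Q))
  /-- the model distribution `𝒟` -/
  D : ∀ q : Q, Submodule ℝ (TangentSpace 𝓘(ℝ, E) q)
  D_regular : ∀ q₀ : Q, ∃ U : Set Q, IsOpen U ∧ q₀ ∈ U ∧
    ∃ μ : Fin m → OneForm E Q, IsAnnihilatorOn D U μ

/-- Transversality `W₁ ⋔ W₂` of affine subspaces of a vector space `V`: `V = W₁ + W₂` and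
`dim V = dim W₁ + dim W₂`. -/
def AffineTransversal {V : Type*} [AddCommGroup V] [Module ℝ V]
    (W₁ W₂ : AffineSubspace ℝ V) : Prop :=
  (W₁ : Set V) + (W₂ : Set V) = univ ∧
    Module.finrank ℝ V = Module.finrank ℝ W₁.direction + Module.finrank ℝ W₂.direction

namespace AffineDistribution

variable {E : Type*} [NormedAddCommGroup E] [NormedSpace ℝ E]
  {Q : Type*} [TopologicalSpace Q] [ChartedSpace E Q] [IsManifold 𝓘(ℝ, E) ∞ Q] {m : ℕ}
  (A : AffineDistribution E Q m)

/-- The affine subspace `𝒜_q = X(q) + 𝒟_q` of `T_qQ`. -/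
def fiber (q : Q) : AffineSubspace ℝ (TangentSpace 𝓘(ℝ, E) q) :=
  AffineSubspace.mk' (A.X q) (A.D q)

/-- `𝒜` as a subset of `TQ`. -/
def carrier : Set (TangentBundle 𝓘(ℝ, E) Q) :=
  {v | v.snd ∈ A.fiber v.proj}

/-- The function `φ(v_q) = μ(q)(v_q) - μ(q)(X(q))` on `TQ` attached to a one-form `μ`. -/
def constraint (μ : OneForm E Q) (v : TangentBundle 𝓘(ℝ, E) Q) : ℝ :=
  μ v.proj v.snd - μ v.proj (A.X v.proj)

/-- `w ∈ T_v(TQ)` is tangent to `𝒜` at `v`: it is the velocity at time `0` of a curve in `𝒜`. -/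
def IsTangentAt (v : TangentBundle 𝓘(ℝ, E) Q) (w : TangentSpace 𝓘(ℝ, E).tangent v) : Prop :=
  ∃ c : ℝ → TangentBundle 𝓘(ℝ, E) Q, (∀ᶠ t in 𝓝 (0 : ℝ), c t ∈ A.carrier) ∧
    MDifferentiableAt 𝓘(ℝ, ℝ) 𝓘(ℝ, E).tangent c 0 ∧
    (⟨c 0, mfderiv 𝓘(ℝ, ℝ) 𝓘(ℝ, E).tangent c 0 (1 : ℝ)⟩ :
      TangentBundle 𝓘(ℝ, E).tangent (TangentBundle 𝓘(ℝ, E) Q)) = ⟨v, w⟩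

/-- `𝒜` is transversal to the input distribution of the system `S` at every point of `Q`. -/
def TransversalToInputs [FiniteDimensional ℝ E] (S : MechanicalControlSystem E Q m) : Prop :=
  ∀ q : Q, AffineTransversal (A.fiber q) (S.inputDistribution q).toAffineSubspace

/-- `u : TQ → ℝ^m` is a smooth extension of the control function `û : 𝒜 → ℝ^m`. -/
structure IsSmoothExtension (û : A.carrier → Fin m → ℝ)
    (u : TangentBundle 𝓘(ℝ, E) Q → Fin m → ℝ) : Prop where
  smooth : ContMDiff 𝓘(ℝ, E).tangent 𝓘(ℝ, Fin m → ℝ) ∞ u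
  eq_on : ∀ v : A.carrier, u v = û v

/-- `𝒜` is invariant under the (possibly only local) flow of the vector field `Γ` on `TQ`: an
integral curve of `Γ` on an open interval that meets `𝒜` stays in `𝒜`. -/
def FlowInvariant (Γ : ∀ v : TangentBundle 𝓘(ℝ, E) Q, TangentSpace 𝓘(ℝ, E).tangent v) : Prop :=
  ∀ (J : Set ℝ) (c : ℝ → TangentBundle 𝓘(ℝ, E) Q), IsOpen J → J.OrdConnected →
    IsMIntegralCurveOn c Γ J → ∀ t₀ ∈ J, c t₀ ∈ A.carrier → ∀ t ∈ J, c t ∈ A.carrier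

/-- The control function `û : 𝒜 → ℝ^m` makes `𝒜` a virtual affine nonholonomic constraint of `S`:
`û` is smooth on the (closed, embedded) submanifold `𝒜` of `TQ`, i.e. it extends smoothly to `TQ`,
and `𝒜` is invariant under the flow of the closed-loop system, whichever extension is used. -/
def IsVirtualConstraintFor [FiniteDimensional ℝ E] (S : MechanicalControlSystem E Q m)
    (û : A.carrier → Fin m → ℝ) : Prop :=
  (∃ u, A.IsSmoothExtension û u) ∧
    ∀ u, A.IsSmoothExtension û u → A.FlowInvariant (S.closedLoopField u)

/-- For the control function `û` on `𝒜` (no regularity), the closed-loop system has a solution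
through `v ∈ 𝒜` that stays in `𝒜` for small times. -/
def HasSolutionThrough [FiniteDimensional ℝ E] (S : MechanicalControlSystem E Q m)
    (û : A.carrier → Fin m → ℝ) (v : A.carrier) : Prop :=
  ∃ c : ℝ → TangentBundle 𝓘(ℝ, E) Q, ∃ ε > 0, c 0 = v ∧ ∀ t ∈ Ioo (-ε) ε,
    ∃ h : c t ∈ A.carrier, HasMFDerivAt 𝓘(ℝ, ℝ) 𝓘(ℝ, E).tangent c t
      ((1 : ℝ →L[ℝ] ℝ).smulRight (S.controlledVector (c t) (û ⟨c t, h⟩)))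

/-- The matrix `P^b_a = μ^b(Y^a)` at `q`. -/
def controlMatrix [FiniteDimensional ℝ E] (S : MechanicalControlSystem E Q m)
    (μ : Fin m → OneForm E Q) (q : Q) : Matrix (Fin m) (Fin m) ℝ :=
  Matrix.of fun b a ↦ μ b q (S.inputField a q)

/-- The vector `b(v)` with entries `-dφ^b(G(v))`. -/
def controlRhs [FiniteDimensional ℝ E] (S : MechanicalControlSystem E Q m)
    (μ : Fin m → OneForm E Q) (v : TangentBundle 𝓘(ℝ, E) Q) : Fin m → ℝ :=
  fun b ↦ -(mfderiv 𝓘(ℝ, E).tangent 𝓘(ℝ, ℝ) (A.constraint (μ b)) v (S.unactuatedField v) : ℝ)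

end AffineDistribution

end

/-! Near each point `𝒜` is the common zero set of the functions `φ^b(v) = μ^b(v - X)`. They are
affine on fibres, so `dφ^b` maps the vertical lift of `Y` to `μ^b(Y)`, and the condition `dφ^b(Γ) =
0` on a control value `τ` is the linear system `P τ = b`. A left null vector of `P` is a combination
of the `μ^b` that kills both `𝒟` and `ℱ`; by transversality it kills `T_qQ`, so it is trivial by
independence, and `P` is invertible (`isUnit_controlMatrix`). Hence at most one control value is
tangent at a point (`eq_of_isTangentAt`). This settles both uniqueness claims, since a solution that
stays in `𝒜` has velocities tangent to `𝒜`.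

For existence, Cramer's rule solves the system over all of `π⁻¹(U)`, on `𝒜` and off it, so each
`φ^b` is constant along the integral curves of this local closed loop. Those starting in `𝒜`
therefore stay in it for short times, and they are themselves the curves that witness tangency; no
submanifold structure on `𝒜` is needed. The local feedbacks agree on `𝒜` by uniqueness, and a
partition of unity on `TQ` yields a smooth extension. Any smooth extension `u` of the resulting
control agrees on `𝒜` with the local feedbacks, so their integral curves in `𝒜` are also integral
curves of `Γ_u`; uniqueness for ODEs, closedness of `𝒜` and connectedness of the time interval give
invariance.

All of this rests on smoothness of the spray, which is defined at each `v` in a chart that moves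
with `v`. Read in one fixed chart, the second derivative of the chart transition appears both in the
coordinate change of `T(TQ)` and in the transformation law of the Christoffel symbols, and the two
cancel (`tangentCoordChange_secondOrderField`). -/

noncomputable section

/-! ### Christoffel symbols of the first kind under a change of variables. -/

section Calculus

variable {E : Type*} [NormedAddCommGroup E] [NormedSpace ℝ E]

set_option synthInstance.maxHeartbeats 200000 in
theorem fderiv_pullback_bilin {h h' : E → E →L[ℝ] E →L[ℝ] ℝ} {ψ : E → E} {x : E}
    (hψ : ContDiffAt ℝ 2 ψ x) (hh : DifferentiableAt ℝ h (ψ x))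
    (heq : h' =ᶠ[𝓝 x] fun y ↦ (h (ψ y)).bilinearComp (fderiv ℝ ψ y) (fderiv ℝ ψ y))
    (hh' : DifferentiableAt ℝ h' x) (d a b : E) :
    fderiv ℝ h' x d a b = fderiv ℝ h (ψ x) (fderiv ℝ ψ x d) (fderiv ℝ ψ x a) (fderiv ℝ ψ x b) +
      h (ψ x) (fderiv ℝ (fderiv ℝ ψ) x d a) (fderiv ℝ ψ x b) +
      h (ψ x) (fderiv ℝ ψ x a) (fderiv ℝ (fderiv ℝ ψ) x d b) := by
  have hψ1 : HasFDerivAt ψ (fderiv ℝ ψ x) x := (hψ.differentiableAt (by simp)).hasFDerivAt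
  have hψ2 : HasFDerivAt (fderiv ℝ ψ) (fderiv ℝ (fderiv ℝ ψ) x) x :=
    ((hψ.fderiv_right (m := 1) (by norm_num)).differentiableAt (by simp)).hasFDerivAt
  have hc : HasFDerivAt (fun y ↦ h (ψ y)) ((fderiv ℝ h (ψ x)).comp (fderiv ℝ ψ x)) x :=
    HasFDerivAt.comp (G := E →L[ℝ] E →L[ℝ] ℝ) (g := h) x hh.hasFDerivAt hψ1
  have ha := hψ2.clm_apply (hasFDerivAt_const a x)
  have hb := hψ2.clm_apply (hasFDerivAt_const b x)
  have hca := hc.clm_apply ha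
  have key := hca.clm_apply hb
  have h1 : HasFDerivAt (fun y ↦ h' y a b)
      (((fderiv ℝ h' x).flip a).flip b) x := by
    have := (hh'.hasFDerivAt.clm_apply (hasFDerivAt_const a x)).clm_apply (hasFDerivAt_const b x)
    exact this.congr_fderiv (by ext d; simp)
  have h2 : (fun y ↦ h' y a b) =ᶠ[𝓝 x]
      fun y ↦ h (ψ y) (fderiv ℝ ψ y a) (fderiv ℝ ψ y b) := by
    filter_upwards [heq] with y hy
    rw [hy]; rfl
  have h3 := congrArg (fun L : E →L[ℝ] ℝ ↦ L d) ((h1.congr_of_eventuallyEq h2.symm).unique key)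
  simp at h3
  rw [h3]
  ring

/-- The product rule gives six terms containing `D²ψ`. By symmetry of `D²ψ` and of `h`, four of them
cancel in the alternating sum, and the two equal terms `h(D²ψ(a, b), Dψ c)` absorb the factor `1/2`.
This is the source of the inhomogeneous term in the transformation law. -/
theorem christoffelForm_pullback {h h' : E → E →L[ℝ] E →L[ℝ] ℝ} {ψ : E → E} {x : E}
    (hψ : ContDiffAt ℝ 2 ψ x) (hh : DifferentiableAt ℝ h (ψ x))
    (hsymm : ∀ a b, h (ψ x) a b = h (ψ x) b a)
    (heq : h' =ᶠ[𝓝 x] fun y ↦ (h (ψ y)).bilinearComp (fderiv ℝ ψ y) (fderiv ℝ ψ y))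
    (hh' : DifferentiableAt ℝ h' x) (a b c : E) :
    christoffelForm h' x a b c =
      christoffelForm h (ψ x) (fderiv ℝ ψ x a) (fderiv ℝ ψ x b) (fderiv ℝ ψ x c) +
      h (ψ x) (fderiv ℝ (fderiv ℝ ψ) x a b) (fderiv ℝ ψ x c) := by
  have S : ∀ a b, fderiv ℝ (fderiv ℝ ψ) x a b = fderiv ℝ (fderiv ℝ ψ) x b a := fun a b ↦
    (hψ.isSymmSndFDerivAt (by simp)) a b
  have F := fderiv_pullback_bilin hψ hh heq hh'
  simp only [christoffelForm, smul_apply, sub_apply,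
    add_apply, ContinuousLinearMap.flip_apply, F, smul_eq_mul]
  rw [S b a, S c a, S c b, hsymm (fderiv ℝ ψ x a) (fderiv ℝ (fderiv ℝ ψ) x b c),
    hsymm (fderiv ℝ ψ x b) (fderiv ℝ (fderiv ℝ ψ) x a c)]
  ring

/-- A smooth family of continuous linear maps has smooth inverses where it is invertible. -/
theorem ContDiffAt.clm_inverse' {E' F : Type*} [NormedAddCommGroup E'] [NormedSpace ℝ E']
    [NormedAddCommGroup F] [NormedSpace ℝ F] [CompleteSpace E']
    {n : ℕ∞ω} {h : E → E' →L[ℝ] F} {x : E} (hh : ContDiffAt ℝ n h x) (hx : (h x).IsInvertible) :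
    ContDiffAt ℝ n (fun y ↦ (h y).inverse) x := by
  obtain ⟨e, he⟩ := hx
  have := contDiffAt_map_inverse (𝕜 := ℝ) (n := n) e
  rw [he] at this
  exact this.comp x hh

end Calculus

/-! ### Coordinate changes of the tangent bundle as derivatives of chart transitions. -/

section Charts

variable {E : Type*} [NormedAddCommGroup E] [NormedSpace ℝ E]
  {Q : Type*} [TopologicalSpace Q] [ChartedSpace E Q] [IsManifold 𝓘(ℝ, E) ∞ Q]

theorem fderiv_chartChange {p q z : Q} :
    fderiv ℝ (extChartAt 𝓘(ℝ, E) q ∘ (extChartAt 𝓘(ℝ, E) p).symm) (extChartAt 𝓘(ℝ, E) p z) =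
      tangentCoordChange 𝓘(ℝ, E) p q z := by
  rw [tangentCoordChange_def]; simp [fderivWithin_univ]

theorem contDiffAt_chartChange {p q : Q} {x : E} (hx : x ∈ (extChartAt 𝓘(ℝ, E) p).target)
    (hq : (extChartAt 𝓘(ℝ, E) p).symm x ∈ (extChartAt 𝓘(ℝ, E) q).source) :
    ContDiffAt ℝ ∞ (extChartAt 𝓘(ℝ, E) q ∘ (extChartAt 𝓘(ℝ, E) p).symm) x := by
  have := contDiffWithinAt_ext_coord_change (I := 𝓘(ℝ, E)) (n := ∞) q p (y := x) (by
    rw [PartialEquiv.trans_source, PartialEquiv.symm_source]; exact ⟨hx, hq⟩)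
  simpa [contDiffWithinAt_univ] using this

theorem mfderiv_extChartAt_symm {p q : Q} (hq : q ∈ (extChartAt 𝓘(ℝ, E) p).source) :
    (mfderiv 𝓘(ℝ, E) 𝓘(ℝ, E) (extChartAt 𝓘(ℝ, E) p).symm (extChartAt 𝓘(ℝ, E) p q) : E →L[ℝ] E) =
      tangentCoordChange 𝓘(ℝ, E) p q q := by
  have h := TangentBundle.symmL_trivializationAt (I := 𝓘(ℝ, E)) (x₀ := p) (x := q)
    (by rwa [extChartAt_source] at hq)
  rw [TangentBundle.symmL_trivializationAt_eq_core (by rwa [extChartAt_source] at hq)] at h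
  rw [ModelWithCorners.range_eq_univ, mfderivWithin_univ] at h
  exact h.symm

theorem tangentCoordChange_left_inv {p q : Q} (hq : q ∈ (extChartAt 𝓘(ℝ, E) p).source) (v : E) :
    tangentCoordChange 𝓘(ℝ, E) p q q (tangentCoordChange 𝓘(ℝ, E) q p q v) = v := by
  rw [tangentCoordChange_comp ⟨⟨mem_extChartAt_source q, hq⟩, mem_extChartAt_source q⟩,
    tangentCoordChange_self (mem_extChartAt_source q)]

theorem tangentCoordChange_right_inv {p q : Q} (hq : q ∈ (extChartAt 𝓘(ℝ, E) p).source) (v : E) :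
    tangentCoordChange 𝓘(ℝ, E) q p q (tangentCoordChange 𝓘(ℝ, E) p q q v) = v := by
  rw [tangentCoordChange_comp ⟨⟨hq, mem_extChartAt_source q⟩, hq⟩, tangentCoordChange_self hq]

/-- A vector field along a map is smooth iff its coordinates are. -/
theorem contMDiffAt_tangentBundle_iff {EM : Type*} [NormedAddCommGroup EM] [NormedSpace ℝ EM]
    {HM : Type*} [TopologicalSpace HM] {IM : ModelWithCorners ℝ EM HM}
    {M : Type*} [TopologicalSpace M] [ChartedSpace HM M] {n : ℕ∞ω} {b : M → Q}
    {w : ∀ x, TangentSpace 𝓘(ℝ, E) (b x)} {x₀ : M} :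
    ContMDiffAt IM 𝓘(ℝ, E).tangent n (fun x ↦ (⟨b x, w x⟩ : TangentBundle 𝓘(ℝ, E) Q)) x₀ ↔
      ContMDiffAt IM 𝓘(ℝ, E) n b x₀ ∧ ContMDiffAt IM 𝓘(ℝ, E) n
        (fun x ↦ tangentCoordChange 𝓘(ℝ, E) (b x) (b x₀) (b x) (w x)) x₀ :=
  contMDiffAt_totalSpace

/-- The coordinate vector fields of a chart are smooth. -/
theorem contMDiffAt_coordField {p q : Q} (hq : q ∈ (extChartAt 𝓘(ℝ, E) p).source) (a : E) :
    ContMDiffAt 𝓘(ℝ, E) 𝓘(ℝ, E).tangent ∞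
      (fun z ↦ (⟨z, tangentCoordChange 𝓘(ℝ, E) p z z a⟩ : TangentBundle 𝓘(ℝ, E) Q)) q := by
  rw [extChartAt_source] at hq
  have h := (trivializationAt E (TangentSpace 𝓘(ℝ, E)) p).contMDiffAt_symmL (IB := 𝓘(ℝ, E))
    (n := ∞) (x := q) hq
  have h2 := h.clm_bundle_apply (v := fun _ ↦ a) (E₁ := Trivial Q E) (by
    rw [contMDiffAt_totalSpace]
    exact ⟨contMDiffAt_id, contMDiffAt_const⟩)
  refine h2.congr_of_eventuallyEq ?_
  filter_upwards [(chartAt E p).open_source.mem_nhds hq] with z hz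
  rw [TangentBundle.symmL_trivializationAt_eq_core hz]
  rfl

end Charts

/-! ### The metric in a chart and smoothness of the musical isomorphism. -/

namespace SmoothMetric

variable {E : Type*} [NormedAddCommGroup E] [NormedSpace ℝ E]
  {Q : Type*} [TopologicalSpace Q] [ChartedSpace E Q] [IsManifold 𝓘(ℝ, E) ∞ Q]
  (g : SmoothMetric E Q)

theorem inChart_extChartAt {p q : Q} (hq : q ∈ (extChartAt 𝓘(ℝ, E) p).source) (a b : E) :
    g.inChart p (extChartAt 𝓘(ℝ, E) p q) a b =
      g.inner q (tangentCoordChange 𝓘(ℝ, E) p q q a) (tangentCoordChange 𝓘(ℝ, E) p q q b) := by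
  rw [← mfderiv_extChartAt_symm hq]
  -- Every tangent space is `E` by definition; forgetting the dependence of the type on the base
  -- point allows that point to be rewritten.
  let G : Q → E →L[ℝ] E →L[ℝ] ℝ := fun z ↦ g.inner z
  let B : E →L[ℝ] E := mfderiv 𝓘(ℝ, E) 𝓘(ℝ, E) (extChartAt 𝓘(ℝ, E) p).symm (extChartAt 𝓘(ℝ, E) p q)
  change G ((extChartAt 𝓘(ℝ, E) p).symm (extChartAt 𝓘(ℝ, E) p q)) (B a) (B b) = G q (B a) (B b)
  rw [(extChartAt 𝓘(ℝ, E) p).left_inv hq]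

theorem contMDiffAt_inner {EM : Type*} [NormedAddCommGroup EM] [NormedSpace ℝ EM]
    {HM : Type*} [TopologicalSpace HM] {IM : ModelWithCorners ℝ EM HM}
    {M : Type*} [TopologicalSpace M] [ChartedSpace HM M] {b : M → Q}
    {v w : ∀ x, TangentSpace 𝓘(ℝ, E) (b x)} {x₀ : M}
    (hv : ContMDiffAt IM 𝓘(ℝ, E).tangent ∞ (fun x ↦ (⟨b x, v x⟩ : TangentBundle 𝓘(ℝ, E) Q)) x₀)
    (hw : ContMDiffAt IM 𝓘(ℝ, E).tangent ∞ (fun x ↦ (⟨b x, w x⟩ : TangentBundle 𝓘(ℝ, E) Q)) x₀) :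
    ContMDiffAt IM 𝓘(ℝ) ∞ (fun x ↦ g.inner (b x) (v x) (w x)) x₀ := by
  have hb := (contMDiffAt_tangentBundle_iff.1 hv).1
  have : ContMDiffAt IM (𝓘(ℝ, E).prod 𝓘(ℝ)) ∞
      (fun m ↦ TotalSpace.mk' ℝ (E := Bundle.Trivial Q ℝ) (b m) (g.inner (b m) (v m) (w m))) x₀ := by
    apply ContMDiffAt.clm_bundle_apply₂ (F₁ := E) (F₂ := E)
    · exact ContMDiffAt.comp x₀ g.contMDiff.contMDiffAt hb
    · exact hv
    · exact hw
  exact (contMDiffAt_totalSpace.1 this).2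

theorem inChart_symm {p : Q} {x : E} (hx : x ∈ (extChartAt 𝓘(ℝ, E) p).target) (a b : E) :
    g.inChart p x a b = g.inChart p x b a := by
  rw [← (extChartAt 𝓘(ℝ, E) p).right_inv hx,
    g.inChart_extChartAt ((extChartAt 𝓘(ℝ, E) p).map_target hx),
    g.inChart_extChartAt ((extChartAt 𝓘(ℝ, E) p).map_target hx)]
  exact g.symm _ _ _

variable [FiniteDimensional ℝ E]

/-- In finite dimension smoothness can be tested on fixed vectors `a`, `b`, and the resulting
entries are the metric evaluated on smooth coordinate fields. -/
theorem contDiffOn_inChart (p : Q) :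
    ContDiffOn ℝ ∞ (g.inChart p) (extChartAt 𝓘(ℝ, E) p).target := by
  refine contDiffOn_clm_apply.2 fun a ↦ contDiffOn_clm_apply.2 fun b ↦ ?_
  have h : ContMDiffOn 𝓘(ℝ, E) 𝓘(ℝ) ∞ (fun z : Q ↦ g.inner z (tangentCoordChange 𝓘(ℝ, E) p z z a)
      (tangentCoordChange 𝓘(ℝ, E) p z z b)) (extChartAt 𝓘(ℝ, E) p).source := fun z hz ↦
    (g.contMDiffAt_inner (contMDiffAt_coordField hz a)
      (contMDiffAt_coordField hz b)).contMDiffWithinAt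
  have h2 := h.comp (contMDiffOn_extChartAt_symm (I := 𝓘(ℝ, E)) (n := ∞) p)
    (fun x hx ↦ (extChartAt 𝓘(ℝ, E) p).map_target hx)
  refine (contMDiffOn_iff_contDiffOn.1 h2).congr fun x hx ↦ ?_
  conv_lhs => rw [← (extChartAt 𝓘(ℝ, E) p).right_inv hx,
    g.inChart_extChartAt ((extChartAt 𝓘(ℝ, E) p).map_target hx)]
  rfl

theorem contDiffAt_inChart {p : Q} {x : E} (hx : x ∈ (extChartAt 𝓘(ℝ, E) p).target) :
    ContDiffAt ℝ ∞ (g.inChart p) x :=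
  (g.contDiffOn_inChart p).contDiffAt ((isOpen_extChartAt_target p).mem_nhds hx)

theorem isInvertible_inChart {p : Q} {x : E} (hx : x ∈ (extChartAt 𝓘(ℝ, E) p).target) :
    (g.inChart p x).IsInvertible := by
  have hinj : Function.Injective (g.inChart p x).toLinearMap := by
    rw [← LinearMap.ker_eq_bot, LinearMap.ker_eq_bot']
    intro a ha
    have h0 : g.inChart p x a a = 0 := by
      have : g.inChart p x a = 0 := ha
      rw [this]; rfl
    have hs := (extChartAt 𝓘(ℝ, E) p).map_target hx
    rw [← (extChartAt 𝓘(ℝ, E) p).right_inv hx, g.inChart_extChartAt hs] at h0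
    by_contra hne
    refine (g.pos _ (tangentCoordChange 𝓘(ℝ, E) p ((extChartAt 𝓘(ℝ, E) p).symm x)
      ((extChartAt 𝓘(ℝ, E) p).symm x) a) fun h ↦ hne ?_).ne' h0
    have h := congrArg (tangentCoordChange 𝓘(ℝ, E) ((extChartAt 𝓘(ℝ, E) p).symm x) p
      ((extChartAt 𝓘(ℝ, E) p).symm x)) h
    rw [tangentCoordChange_right_inv hs] at h
    exact h.trans (map_zero _)
  let e := LinearMap.linearEquivOfInjective (g.inChart p x).toLinearMap hinj (finrank_cotangent p)
  exact ⟨e.toContinuousLinearEquiv, by ext a b; rfl⟩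

theorem inner_sharp (q : Q) (α : TangentSpace 𝓘(ℝ, E) q →L[ℝ] ℝ) (c : TangentSpace 𝓘(ℝ, E) q) :
    g.inner q (g.sharp q α) c = α c := by
  have : g.flat q (g.sharp q α) = α := (g.flat q).apply_symm_apply α
  exact congrArg (fun β : TangentSpace 𝓘(ℝ, E) q →L[ℝ] ℝ ↦ β c) this

theorem inverse_inChart_apply {p : Q} {x : E} (hx : x ∈ (extChartAt 𝓘(ℝ, E) p).target)
    (α : E →L[ℝ] ℝ) (c : E) : g.inChart p x ((g.inChart p x).inverse α) c = α c := by
  obtain ⟨e, he⟩ := g.isInvertible_inChart hx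
  rw [← he, ContinuousLinearMap.inverse_equiv]
  change (e (e.symm α)) c = _
  rw [e.apply_symm_apply]

theorem eq_of_inChart_eq {p : Q} {x : E} (hx : x ∈ (extChartAt 𝓘(ℝ, E) p).target) {a b : E}
    (h : ∀ c, g.inChart p x a c = g.inChart p x b c) : a = b := by
  obtain ⟨e, he⟩ := g.isInvertible_inChart hx
  rw [← he] at h
  exact e.injective (ContinuousLinearMap.ext h)

/-- Both sides represent the same covector with respect to the metric in the chart at `p`, which is
nondegenerate. The right side uses a single chart, so its smooth dependence on `q` can be read off
from smoothness of operator inversion. -/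
theorem tangentCoordChange_sharp {p q : Q} (hq : q ∈ (extChartAt 𝓘(ℝ, E) p).source)
    (α : E →L[ℝ] ℝ) :
    tangentCoordChange 𝓘(ℝ, E) q p q (g.sharp q α) =
      (g.inChart p (extChartAt 𝓘(ℝ, E) p q)).inverse
        (α.comp (tangentCoordChange 𝓘(ℝ, E) p q q)) := by
  refine g.eq_of_inChart_eq ((extChartAt 𝓘(ℝ, E) p).map_source hq) fun c ↦ ?_
  rw [g.inverse_inChart_apply ((extChartAt 𝓘(ℝ, E) p).map_source hq), g.inChart_extChartAt hq]
  refine Eq.trans ?_ (g.inner_sharp q α _)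
  exact congrArg (fun v : E ↦ g.inner q v (tangentCoordChange 𝓘(ℝ, E) p q q c))
    (tangentCoordChange_left_inv hq _)

theorem contMDiffAt_sharp {EM : Type*} [NormedAddCommGroup EM] [NormedSpace ℝ EM]
    {HM : Type*} [TopologicalSpace HM] {IM : ModelWithCorners ℝ EM HM}
    {M : Type*} [TopologicalSpace M] [ChartedSpace HM M] {b : M → Q}
    {α : ∀ x, TangentSpace 𝓘(ℝ, E) (b x) →L[ℝ] ℝ} {x₀ : M}
    (hα : ContMDiffAt IM (𝓘(ℝ, E).prod 𝓘(ℝ, E →L[ℝ] ℝ)) ∞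
      (fun x ↦ TotalSpace.mk' (E →L[ℝ] ℝ)
        (E := fun q : Q ↦ TangentSpace 𝓘(ℝ, E) q →L[ℝ] ℝ) (b x) (α x)) x₀) :
    ContMDiffAt IM 𝓘(ℝ, E).tangent ∞
      (fun x ↦ (⟨b x, g.sharp (b x) (α x)⟩ : TangentBundle 𝓘(ℝ, E) Q)) x₀ := by
  rw [contMDiffAt_hom_bundle] at hα
  obtain ⟨hb, hc⟩ := hα
  have hb : ContMDiffAt IM 𝓘(ℝ, E) ∞ b x₀ := hb
  refine contMDiffAt_tangentBundle_iff.2 ⟨hb, ?_⟩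
  have hsrc : ∀ᶠ x in 𝓝 x₀, b x ∈ (extChartAt 𝓘(ℝ, E) (b x₀)).source :=
    hb.continuousAt.preimage_mem_nhds (extChartAt_source_mem_nhds _)
  have h1 : ContMDiffAt IM 𝓘(ℝ, E) ∞ (fun x ↦ extChartAt 𝓘(ℝ, E) (b x₀) (b x)) x₀ :=
    contMDiffAt_extChartAt.comp x₀ hb
  have h2 : ContMDiffAt IM 𝓘(ℝ, (E →L[ℝ] ℝ) →L[ℝ] E) ∞
      (fun x ↦ (g.inChart (b x₀) (extChartAt 𝓘(ℝ, E) (b x₀) (b x))).inverse) x₀ :=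
    (ContDiffAt.clm_inverse' (g.contDiffAt_inChart (mem_extChartAt_target (b x₀)))
      (g.isInvertible_inChart (mem_extChartAt_target (b x₀)))).contMDiffAt.comp x₀ h1
  refine (h2.clm_apply hc).congr_of_eventuallyEq ?_
  filter_upwards [hsrc] with x hx
  refine (g.tangentCoordChange_sharp hx (α x)).trans ?_
  congr 1
  rw [extChartAt_source] at hx
  ext c
  simp only [ContinuousLinearMap.inCoordinates, ContinuousLinearMap.comp_apply]
  rw [TangentBundle.symmL_trivializationAt_eq_core hx]
  exact congrArg (fun L : ℝ →L[ℝ] ℝ ↦ L (α x (tangentCoordChange 𝓘(ℝ, E) (b x₀) (b x) (b x) c)))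
    (Bundle.Trivial.continuousLinearMapAt_trivialization (𝕜 := ℝ) Q ℝ (b x)).symm
end SmoothMetric

/-! ### Curves in `Q` and `TQ`, the charts of `T(TQ)`, vertical lifts. -/

section Curves

theorem hasMFDerivAt_curve_iff {F : Type*} [NormedAddCommGroup F] [NormedSpace ℝ F]
    {H : Type*} [TopologicalSpace H] {I : ModelWithCorners ℝ F H}
    {M : Type*} [TopologicalSpace M] [ChartedSpace H M]
    {c : ℝ → M} {t : ℝ} {w : TangentSpace I (c t)} :
    HasMFDerivAt 𝓘(ℝ, ℝ) I c t ((1 : ℝ →L[ℝ] ℝ).smulRight w) ↔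
      ContinuousAt c t ∧ HasDerivAt (F := F) (fun s ↦ extChartAt I (c t) (c s)) w t := by
  have h : HasDerivAt (F := F) (fun s ↦ extChartAt I (c t) (c s)) w t ↔
      HasFDerivWithinAt (F := F) (fun s ↦ extChartAt I (c t) (c s))
        ((1 : ℝ →L[ℝ] ℝ).smulRight (show F from w)) (range 𝓘(ℝ, ℝ)) t := by
    rw [ModelWithCorners.range_eq_univ, hasFDerivWithinAt_univ]
    exact hasDerivAt_iff_hasFDerivAt
  exact ⟨fun h' ↦ ⟨h'.1, h.2 h'.2⟩, fun h' ↦ ⟨h'.1, h.1 h'.2⟩⟩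

variable {E : Type*} [NormedAddCommGroup E] [NormedSpace ℝ E]
  {Q : Type*} [TopologicalSpace Q] [ChartedSpace E Q] [IsManifold 𝓘(ℝ, E) ∞ Q]

theorem extChartAt_tangentBundle_apply (v z : TangentBundle 𝓘(ℝ, E) Q) :
    extChartAt 𝓘(ℝ, E).tangent v z =
      ((extChartAt 𝓘(ℝ, E) v.proj z.proj,
        tangentCoordChange 𝓘(ℝ, E) z.proj v.proj z.proj z.snd) : E × E) := rfl

theorem extChartAt_tangentBundle_symm_apply (v : TangentBundle 𝓘(ℝ, E) Q) (z : E × E) :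
    (extChartAt 𝓘(ℝ, E).tangent v).symm z =
      (⟨(extChartAt 𝓘(ℝ, E) v.proj).symm z.1,
        tangentCoordChange 𝓘(ℝ, E) v.proj ((extChartAt 𝓘(ℝ, E) v.proj).symm z.1)
          ((extChartAt 𝓘(ℝ, E) v.proj).symm z.1) z.2⟩ : TangentBundle 𝓘(ℝ, E) Q) := rfl

/-- The coordinate changes of `T(TQ)`. -/
theorem tangentCoordChange_tangentBundle {v₀ v : TangentBundle 𝓘(ℝ, E) Q}
    (hv : v.proj ∈ (extChartAt 𝓘(ℝ, E) v₀.proj).source) (a b : E) :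
    tangentCoordChange 𝓘(ℝ, E).tangent v v₀ v ((a, b) : E × E) =
      ((tangentCoordChange 𝓘(ℝ, E) v.proj v₀.proj v.proj a,
        fderiv ℝ (fderiv ℝ (extChartAt 𝓘(ℝ, E) v₀.proj ∘ (extChartAt 𝓘(ℝ, E) v.proj).symm))
          (extChartAt 𝓘(ℝ, E) v.proj v.proj) a v.snd +
        tangentCoordChange 𝓘(ℝ, E) v.proj v₀.proj v.proj b) : E × E) := by
  set φ := extChartAt 𝓘(ℝ, E) v.proj with hφ
  set ψ : E → E := extChartAt 𝓘(ℝ, E) v₀.proj ∘ φ.symm with hψ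
  have hsm : ContDiffAt ℝ ∞ ψ (φ v.proj) :=
    contDiffAt_chartChange (mem_extChartAt_target v.proj) (by rwa [extChartAt_to_inv])
  have h1 : HasFDerivAt ψ (fderiv ℝ ψ (φ v.proj)) (φ v.proj) :=
    (hsm.differentiableAt (by simp)).hasFDerivAt
  have h2 : HasFDerivAt (fderiv ℝ ψ) (fderiv ℝ (fderiv ℝ ψ) (φ v.proj)) (φ v.proj) :=
    ((hsm.fderiv_right (m := 1) (by norm_cast)).differentiableAt (by simp)).hasFDerivAt
  have hpt : extChartAt 𝓘(ℝ, E).tangent v v = ((φ v.proj, (v.snd : E)) : E × E) := by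
    exact Prod.ext rfl (tangentCoordChange_self (mem_extChartAt_source _))
  -- The transition map of `TQ` is `(x, y) ↦ (ψ x, Dψ(x) y)`; differentiating its second component
  -- in `x` produces the `D²ψ` term.
  have heq : (extChartAt 𝓘(ℝ, E).tangent v₀ ∘ (extChartAt 𝓘(ℝ, E).tangent v).symm : E × E → E × E)
      =ᶠ[𝓝 ((φ v.proj, (v.snd : E)) : E × E)] fun z ↦ (ψ z.1, fderiv ℝ ψ z.1 z.2) := by
    have ht : ∀ᶠ x in 𝓝 (φ v.proj), x ∈ φ.target ∧
        φ.symm x ∈ (extChartAt 𝓘(ℝ, E) v₀.proj).source :=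
      Filter.Eventually.and (extChartAt_target_mem_nhds v.proj)
        ((continuousAt_extChartAt_symm v.proj).preimage_mem_nhds
          (by rw [extChartAt_to_inv]; exact (isOpen_extChartAt_source _).mem_nhds hv))
    have ht' := (continuousAt_fst (p := ((φ v.proj, (v.snd : E)) : E × E))).eventually ht
    filter_upwards [ht'] with z hz
    rw [Function.comp_apply, extChartAt_tangentBundle_symm_apply, extChartAt_tangentBundle_apply]
    dsimp only
    rw [tangentCoordChange_comp ⟨⟨φ.map_target hz.1, mem_extChartAt_source _⟩, hz.2⟩,
      ← fderiv_chartChange, ← hφ, φ.right_inv hz.1]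
    rfl
  rw [tangentCoordChange_def, ModelWithCorners.range_eq_univ, fderivWithin_univ, hpt]
  have hd : HasFDerivAt (fun z : E × E ↦ (ψ z.1, fderiv ℝ ψ z.1 z.2)) _
      ((φ v.proj, (v.snd : E)) : E × E) :=
    HasFDerivAt.prodMk (HasFDerivAt.comp (g := ψ) _ h1 hasFDerivAt_fst)
      (HasFDerivAt.clm_apply (HasFDerivAt.comp (g := fderiv ℝ ψ) (G := E →L[ℝ] E)
        _ h2 hasFDerivAt_fst) hasFDerivAt_snd)
  have hd' := (hd.congr_of_eventuallyEq heq).fderiv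
  refine (congrArg (fun L : E × E →L[ℝ] E × E ↦ L (a, b)) hd').trans ?_
  have e1 : fderiv ℝ ψ (φ v.proj) = tangentCoordChange 𝓘(ℝ, E) v.proj v₀.proj v.proj :=
    fderiv_chartChange
  rw [e1]
  refine Prod.ext rfl ?_
  exact add_comm _ _

theorem hasMFDerivAt_vertical (v : TangentBundle 𝓘(ℝ, E) Q) (w : TangentSpace 𝓘(ℝ, E) v.proj) :
    HasMFDerivAt 𝓘(ℝ, ℝ) 𝓘(ℝ, E).tangent
      (fun t : ℝ ↦ (⟨v.proj, v.snd + t • w⟩ : TangentBundle 𝓘(ℝ, E) Q)) 0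
      ((1 : ℝ →L[ℝ] ℝ).smulRight (((0 : E), (w : E)) : E × E)) := by
  let c : ℝ → TangentBundle 𝓘(ℝ, E) Q := fun t ↦ ⟨v.proj, v.snd + t • w⟩
  let vE : E := v.snd
  let wE : E := w
  have hc : ∀ t : ℝ, tangentCoordChange 𝓘(ℝ, E) v.proj v.proj v.proj (vE + t • wE) =
      vE + t • wE := fun t ↦ tangentCoordChange_self (mem_extChartAt_source _)
  have hd : HasDerivAt (fun t : ℝ ↦ vE + t • wE) wE 0 := by
    simpa using ((hasDerivAt_id (0 : ℝ)).smul_const wE).const_add vE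
  refine hasMFDerivAt_curve_iff.2 ⟨?_, ?_⟩
  · refine (FiberBundle.continuousAt_totalSpace E c).2 ⟨continuousAt_const, ?_⟩
    exact hd.continuousAt.congr (Filter.Eventually.of_forall fun t ↦ (hc t).symm)
  · have : HasDerivAt (fun t : ℝ ↦ ((extChartAt 𝓘(ℝ, E) v.proj v.proj,
        vE + t • wE) : E × E)) ((0, wE) : E × E) 0 :=
      (hasDerivAt_const _ _).prodMk hd
    exact this.congr_of_eventuallyEq (Filter.Eventually.of_forall fun t ↦
      Prod.ext rfl (hc t))

theorem verticalLift_eq (v : TangentBundle 𝓘(ℝ, E) Q) (w : TangentSpace 𝓘(ℝ, E) v.proj) :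
    verticalLift v w = (((0 : E), (w : E)) : E × E) :=
  (congrArg (fun L : ℝ →L[ℝ] E × E ↦ L 1) (hasMFDerivAt_vertical v w).mfderiv).trans
    (one_smul ℝ (((0 : E), (w : E)) : E × E))

end Curves

/-! ### Smoothness of second order vector fields on `TQ`. -/

section Spray

/-- Coordinate model of the spray: `F` plays the inverse metric, `Φ` the Christoffel form on the
diagonal, and `w` the prescribed acceleration. -/
theorem contMDiffAt_spray_coordinates {E : Type*} [NormedAddCommGroup E] [NormedSpace ℝ E]
    {EM : Type*} [NormedAddCommGroup EM] [NormedSpace ℝ EM]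
    {HM : Type*} [TopologicalSpace HM] {IM : ModelWithCorners ℝ EM HM}
    {M : Type*} [TopologicalSpace M] [ChartedSpace HM M] {n : ℕ∞ω} {m₀ : M}
    {F : E → (E →L[ℝ] ℝ) →L[ℝ] E} {Φ : E × E → E →L[ℝ] ℝ} {x v w : M → E}
    (hF : ContDiffAt ℝ n F (x m₀)) (hΦ : ContDiffAt ℝ n Φ (x m₀, v m₀))
    (hx : ContMDiffAt IM 𝓘(ℝ, E) n x m₀) (hv : ContMDiffAt IM 𝓘(ℝ, E) n v m₀)
    (hw : ContMDiffAt IM 𝓘(ℝ, E) n w m₀) :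
    ContMDiffAt IM 𝓘(ℝ, E × E) n (fun m ↦ (v m, w m - F (x m) (Φ (x m, v m)))) m₀ :=
  hv.prodMk_space (hw.sub ((hF.comp_contMDiffAt hx).clm_apply
    (ContDiffAt.comp_contMDiffAt (g := Φ) (f := fun m ↦ (x m, v m)) hΦ
      (hx.prodMk_space hv))))

theorem ContDiffOn.fderiv_fst_apply {E F : Type*} [NormedAddCommGroup E] [NormedSpace ℝ E]
    [NormedAddCommGroup F] [NormedSpace ℝ F] {h : E → F} {s : Set E} (hh : ContDiffOn ℝ ∞ h s)
    (hs : IsOpen s) {u : E × E → E} (hu : ContDiffOn ℝ ∞ u (s ×ˢ univ)) :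
    ContDiffOn ℝ ∞ (fun p : E × E ↦ fderiv ℝ h p.1 (u p)) (s ×ˢ univ) :=
  ((hh.fderiv_of_isOpen hs (m := ∞) (by simp)).comp contDiff_fst.contDiffOn
    fun _ hp ↦ hp.1).clm_apply hu

theorem ContDiffOn.christoffelForm {E : Type*} [NormedAddCommGroup E] [NormedSpace ℝ E]
    [FiniteDimensional ℝ E] {h : E → E →L[ℝ] E →L[ℝ] ℝ} {s : Set E} (hh : ContDiffOn ℝ ∞ h s)
    (hs : IsOpen s) :
    ContDiffOn ℝ ∞ (fun p : E × E ↦ christoffelForm h p.1 p.2 p.2) (s ×ˢ univ) := by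
  have h2 : ContDiffOn ℝ ∞ (fun p : E × E ↦ p.2) (s ×ˢ univ) := contDiff_snd.contDiffOn
  refine contDiffOn_clm_apply.2 fun c ↦ ?_
  have hc : ContDiffOn ℝ ∞ (fun _ : E × E ↦ c) (s ×ˢ univ) := contDiffOn_const
  have h1 := ((hh.fderiv_fst_apply hs h2).clm_apply h2).clm_apply hc
  have h3 := ((hh.fderiv_fst_apply hs hc).clm_apply h2).clm_apply h2
  exact contDiffOn_const (c := (1 / 2 : ℝ)).mul ((h1.add h1).sub h3)

variable {E : Type*} [NormedAddCommGroup E] [NormedSpace ℝ E]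
  {Q : Type*} [TopologicalSpace Q] [ChartedSpace E Q] [IsManifold 𝓘(ℝ, E) ∞ Q]

theorem SmoothMetric.inChart_eventuallyEq_pullback (g : SmoothMetric E Q) {p q : Q}
    (hq : q ∈ (extChartAt 𝓘(ℝ, E) p).source) :
    g.inChart q =ᶠ[𝓝 (extChartAt 𝓘(ℝ, E) q q)] fun y ↦
      (g.inChart p ((extChartAt 𝓘(ℝ, E) p ∘ (extChartAt 𝓘(ℝ, E) q).symm) y)).bilinearComp
        (fderiv ℝ (extChartAt 𝓘(ℝ, E) p ∘ (extChartAt 𝓘(ℝ, E) q).symm) y)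
        (fderiv ℝ (extChartAt 𝓘(ℝ, E) p ∘ (extChartAt 𝓘(ℝ, E) q).symm) y) := by
  filter_upwards [extChartAt_target_mem_nhds (I := 𝓘(ℝ, E)) q,
    (continuousAt_extChartAt_symm (I := 𝓘(ℝ, E)) q).preimage_mem_nhds
      (by rw [extChartAt_to_inv]; exact (isOpen_extChartAt_source p).mem_nhds hq)] with y hy hyp
  obtain ⟨z, hz, rfl⟩ : ∃ z ∈ (extChartAt 𝓘(ℝ, E) q).source, extChartAt 𝓘(ℝ, E) q z = y :=
    ⟨_, (extChartAt 𝓘(ℝ, E) q).map_target hy, (extChartAt 𝓘(ℝ, E) q).right_inv hy⟩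
  rw [mem_preimage, (extChartAt 𝓘(ℝ, E) q).left_inv hz] at hyp
  have hzz := mem_extChartAt_source (I := 𝓘(ℝ, E)) z
  ext a b
  rw [fderiv_chartChange, ContinuousLinearMap.bilinearComp_apply, Function.comp_apply,
    (extChartAt 𝓘(ℝ, E) q).left_inv hz, g.inChart_extChartAt hz, g.inChart_extChartAt hyp,
    tangentCoordChange_comp ⟨⟨hz, hyp⟩, hzz⟩, tangentCoordChange_comp ⟨⟨hz, hyp⟩, hzz⟩]

variable [FiniteDimensional ℝ E]

/-- The transformation law of the Christoffel symbols. -/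
theorem SmoothMetric.tangentCoordChange_christoffel (g : SmoothMetric E Q) {p q : Q}
    (hq : q ∈ (extChartAt 𝓘(ℝ, E) p).source) (y : E) :
    tangentCoordChange 𝓘(ℝ, E) q p q (g.christoffel q y y) =
      (g.inChart p (extChartAt 𝓘(ℝ, E) p q)).inverse
        (christoffelForm (g.inChart p) (extChartAt 𝓘(ℝ, E) p q)
          (tangentCoordChange 𝓘(ℝ, E) q p q y) (tangentCoordChange 𝓘(ℝ, E) q p q y)) +
      fderiv ℝ (fderiv ℝ (extChartAt 𝓘(ℝ, E) p ∘ (extChartAt 𝓘(ℝ, E) q).symm))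
          (extChartAt 𝓘(ℝ, E) q q) y y := by
  have hx := (extChartAt 𝓘(ℝ, E) p).map_source hq
  have hqq := mem_extChartAt_target (I := 𝓘(ℝ, E)) q
  have hψ : ContDiffAt ℝ ∞ (extChartAt 𝓘(ℝ, E) p ∘ (extChartAt 𝓘(ℝ, E) q).symm)
      (extChartAt 𝓘(ℝ, E) q q) := contDiffAt_chartChange hqq (by rwa [extChartAt_to_inv])
  have hpt : (extChartAt 𝓘(ℝ, E) p ∘ (extChartAt 𝓘(ℝ, E) q).symm) (extChartAt 𝓘(ℝ, E) q q) =
      extChartAt 𝓘(ℝ, E) p q := by rw [Function.comp_apply, extChartAt_to_inv]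
  -- The test vector is pulled back by the inverse Jacobian, so that `Dψ` returns it to the
  -- arbitrary vector `c` of the chart at `p`.
  have key := fun c ↦ christoffelForm_pullback (h := g.inChart p) (h' := g.inChart q)
    (a := y) (b := y) (c := tangentCoordChange 𝓘(ℝ, E) p q q c) (hψ.of_le (by norm_cast))
    ((g.contDiffAt_inChart (hpt ▸ hx)).differentiableAt (by simp))
    (g.inChart_symm (hpt ▸ hx)) (g.inChart_eventuallyEq_pullback hq)
    ((g.contDiffAt_inChart hqq).differentiableAt (by simp))
  refine g.eq_of_inChart_eq hx fun c ↦ ?_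
  rw [map_add, add_apply, g.inverse_inChart_apply hx]
  have key := key c
  rw [hpt, fderiv_chartChange, tangentCoordChange_right_inv hq] at key
  rw [← key, g.inChart_extChartAt hq]
  refine Eq.trans ?_ (g.inner_sharp q (christoffelForm (E := E) (g.inChart q)
    (extChartAt 𝓘(ℝ, E) q q) y y) _)
  exact congrArg (fun v : E ↦ g.inner q v (tangentCoordChange 𝓘(ℝ, E) p q q c))
    (tangentCoordChange_left_inv hq _)

/-- The `D²ψ` term in the coordinate change of `T(TQ)` cancels the inhomogeneous term in the law for
`Γ`. What remains involves the metric in the chart at `v₀.proj` only, which makes smoothness at `v₀`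
visible. -/
theorem tangentCoordChange_secondOrderField (g : SmoothMetric E Q)
    {v v₀ : TangentBundle 𝓘(ℝ, E) Q} (hv : v.proj ∈ (extChartAt 𝓘(ℝ, E) v₀.proj).source)
    (w : TangentSpace 𝓘(ℝ, E) v.proj) :
    tangentCoordChange 𝓘(ℝ, E).tangent v v₀ v (geodesicField g v + verticalLift v w) =
      ((tangentCoordChange 𝓘(ℝ, E) v.proj v₀.proj v.proj v.snd,
        tangentCoordChange 𝓘(ℝ, E) v.proj v₀.proj v.proj w -
          (g.inChart v₀.proj (extChartAt 𝓘(ℝ, E) v₀.proj v.proj)).inverse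
            (christoffelForm (g.inChart v₀.proj) (extChartAt 𝓘(ℝ, E) v₀.proj v.proj)
              (tangentCoordChange 𝓘(ℝ, E) v.proj v₀.proj v.proj v.snd)
              (tangentCoordChange 𝓘(ℝ, E) v.proj v₀.proj v.proj v.snd))) : E × E) := by
  let vE : E := v.snd
  let wE : E := w
  let ΓE : E := g.christoffel v.proj v.snd v.snd
  have e : geodesicField g v + verticalLift v w = ((vE, -ΓE + wE) : E × E) := by
    rw [verticalLift_eq]
    exact Prod.ext (add_zero vE) rfl
  refine (congrArg (tangentCoordChange 𝓘(ℝ, E).tangent v v₀ v) e).trans ?_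
  refine (tangentCoordChange_tangentBundle hv vE (-ΓE + wE)).trans ?_
  refine Prod.ext rfl ?_
  have hc : tangentCoordChange 𝓘(ℝ, E) v.proj v₀.proj v.proj ΓE = _ :=
    g.tangentCoordChange_christoffel hv vE
  dsimp only
  rw [map_add, map_neg, hc, neg_add]
  change _ = tangentCoordChange 𝓘(ℝ, E) v.proj v₀.proj v.proj wE - _
  abel

/-- The second order vector field `(v, w - Γ(v, v))` on `TQ` is smooth where the acceleration `w`
is. -/
theorem contMDiffAt_secondOrderField (g : SmoothMetric E Q) {n : ℕ∞ω} (hn : n ≤ ∞)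
    {w : ∀ v : TangentBundle 𝓘(ℝ, E) Q, TangentSpace 𝓘(ℝ, E) v.proj}
    {v₀ : TangentBundle 𝓘(ℝ, E) Q}
    (hw : ContMDiffAt 𝓘(ℝ, E).tangent 𝓘(ℝ, E).tangent n
      (fun v ↦ (⟨v.proj, w v⟩ : TangentBundle 𝓘(ℝ, E) Q)) v₀) :
    ContMDiffAt 𝓘(ℝ, E).tangent 𝓘(ℝ, E).tangent.tangent n
      (fun v ↦ (⟨v, geodesicField g v + verticalLift v (w v)⟩ :
        TangentBundle 𝓘(ℝ, E).tangent (TangentBundle 𝓘(ℝ, E) Q))) v₀ := by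
  obtain ⟨hπ, hw⟩ := contMDiffAt_tangentBundle_iff.1 hw
  have hv : ContMDiffAt 𝓘(ℝ, E).tangent 𝓘(ℝ, E) n (fun v : TangentBundle 𝓘(ℝ, E) Q ↦
      tangentCoordChange 𝓘(ℝ, E) v.proj v₀.proj v.proj v.snd) v₀ :=
    (contMDiffAt_tangentBundle_iff.1 (contMDiffAt_id (x := v₀))).2
  refine contMDiffAt_totalSpace.2 ⟨contMDiffAt_id, ?_⟩
  have hx : ContMDiffAt 𝓘(ℝ, E).tangent 𝓘(ℝ, E) n
      (fun v : TangentBundle 𝓘(ℝ, E) Q ↦ extChartAt 𝓘(ℝ, E) v₀.proj v.proj) v₀ :=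
    ContMDiffAt.comp (I' := 𝓘(ℝ, E)) v₀ contMDiffAt_extChartAt hπ
  have ht := mem_extChartAt_target (I := 𝓘(ℝ, E)) v₀.proj
  have hF : ContDiffAt ℝ n (fun x ↦ (g.inChart v₀.proj x).inverse)
      (extChartAt 𝓘(ℝ, E) v₀.proj v₀.proj) :=
    ((g.contDiffAt_inChart ht).clm_inverse' (g.isInvertible_inChart ht)).of_le hn
  have hΓ : ContDiffAt ℝ n
      (fun p : E × E ↦ christoffelForm (g.inChart v₀.proj) p.1 p.2 p.2)
      (extChartAt 𝓘(ℝ, E) v₀.proj v₀.proj,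
        tangentCoordChange 𝓘(ℝ, E) v₀.proj v₀.proj v₀.proj v₀.snd) :=
    (((g.contDiffOn_inChart v₀.proj).christoffelForm (isOpen_extChartAt_target _)).contDiffAt
      (((isOpen_extChartAt_target v₀.proj).prod isOpen_univ).mem_nhds ⟨ht, mem_univ _⟩)).of_le hn
  refine (contMDiffAt_spray_coordinates (m₀ := v₀)
    (x := fun v : TangentBundle 𝓘(ℝ, E) Q ↦ extChartAt 𝓘(ℝ, E) v₀.proj v.proj)
    hF hΓ hx hv hw).congr_of_eventuallyEq ?_
  have hsrc : ∀ᶠ v in 𝓝 v₀, v.proj ∈ (extChartAt 𝓘(ℝ, E) v₀.proj).source :=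
    hπ.continuousAt.preimage_mem_nhds (extChartAt_source_mem_nhds _)
  filter_upwards [hsrc] with v hv
  exact tangentCoordChange_secondOrderField g hv (w v)

end Spray

/-! ### Velocities of curves read in a fixed chart. -/

section Velocity

variable {E : Type*} [NormedAddCommGroup E] [NormedSpace ℝ E]
  {Q : Type*} [TopologicalSpace Q] [ChartedSpace E Q]

theorem velocity_hasMFDerivAt {q : ℝ → Q} {t : ℝ} (hq : MDifferentiableAt 𝓘(ℝ, ℝ) 𝓘(ℝ, E) q t) :
    HasMFDerivAt 𝓘(ℝ, ℝ) 𝓘(ℝ, E) q t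
      ((1 : ℝ →L[ℝ] ℝ).smulRight (velocity (E := E) q t)) := by
  have h := hq.hasMFDerivAt
  have e : (mfderiv 𝓘(ℝ, ℝ) 𝓘(ℝ, E) q t : ℝ →L[ℝ] E) =
      (1 : ℝ →L[ℝ] ℝ).smulRight (show E from velocity (E := E) q t) := by
    ext
    exact (one_smul ℝ (show E from velocity (E := E) q t)).symm
  exact e ▸ h

theorem velocity_eq_of_hasMFDerivAt {q : ℝ → Q} {t : ℝ} {w : TangentSpace 𝓘(ℝ, E) (q t)}
    (h : HasMFDerivAt 𝓘(ℝ, ℝ) 𝓘(ℝ, E) q t ((1 : ℝ →L[ℝ] ℝ).smulRight w)) :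
    velocity q t = w :=
  (congrArg (fun L : ℝ →L[ℝ] E ↦ L 1) h.mfderiv).trans (one_smul ℝ (show E from w))

variable [IsManifold 𝓘(ℝ, E) ∞ Q]

/-- The velocity at each time is expressed in the chart at the point reached at that time; a second
differentiation needs one chart `p` for all nearby times. -/
theorem hasDerivAt_extChartAt_curve {q : ℝ → Q} {t : ℝ} {p : Q}
    (hq : MDifferentiableAt 𝓘(ℝ, ℝ) 𝓘(ℝ, E) q t) (hp : q t ∈ (extChartAt 𝓘(ℝ, E) p).source) :
    HasDerivAt (fun s ↦ extChartAt 𝓘(ℝ, E) p (q s))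
      (tangentCoordChange 𝓘(ℝ, E) (q t) p (q t) (velocity q t)) t := by
  obtain ⟨hc, hd⟩ := hasMFDerivAt_curve_iff.1 (velocity_hasMFDerivAt hq)
  have h := (hasFDerivWithinAt_tangentCoordChange (I := 𝓘(ℝ, E))
    ⟨mem_extChartAt_source (q t), hp⟩)
  rw [ModelWithCorners.range_eq_univ, hasFDerivWithinAt_univ] at h
  refine (h.comp_hasDerivAt t hd).congr_of_eventuallyEq ?_
  filter_upwards [hc.preimage_mem_nhds (extChartAt_source_mem_nhds (I := 𝓘(ℝ, E)) (q t))] with s hs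
  exact congrArg _ ((extChartAt 𝓘(ℝ, E) (q t)).left_inv hs).symm

end Velocity

/-! ### The closed-loop field: smoothness and integral curves. -/

namespace MechanicalControlSystem

variable {E : Type*} [NormedAddCommGroup E] [NormedSpace ℝ E] [FiniteDimensional ℝ E]
  {Q : Type*} [TopologicalSpace Q] [ChartedSpace E Q] [IsManifold 𝓘(ℝ, E) ∞ Q] {m : ℕ}
  (S : MechanicalControlSystem E Q m)

/-- The covariant acceleration `Y⁰(v) + ∑ τ_a Y^a` prescribed at `v` by the control value `τ`. -/
def acceleration (v : TangentBundle 𝓘(ℝ, E) Q) (τ : Fin m → ℝ) : TangentSpace 𝓘(ℝ, E) v.proj :=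
  S.drift v + ∑ a, τ a • S.inputField a v.proj

/-- The vertical lift is linear on each fibre, so drift and inputs merge into one acceleration and
the results on second order fields apply. -/
theorem controlledVector_eq (v : TangentBundle 𝓘(ℝ, E) Q) (τ : Fin m → ℝ) :
    S.controlledVector v τ =
      geodesicField S.metric v + verticalLift v (S.acceleration v τ) := by
  let d : E := S.drift v
  let y : Fin m → E := fun a ↦ S.inputField a v.proj
  have h : ((0, d) : E × E) + ∑ a, τ a • ((0, y a) : E × E) = (0, d + ∑ a, τ a • y a) := by
    refine Prod.ext ?_ ?_
    · simp [Prod.fst_sum]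
    · simp [Prod.snd_sum]
  have h' : verticalLift v (S.drift v) + ∑ a, τ a • verticalLift v (S.inputField a v.proj) =
      verticalLift v (S.acceleration v τ) := by
    simp_rw [verticalLift_eq]
    exact h
  rw [← h', ← add_assoc]
  rfl

theorem contMDiffAt_drift (v : TangentBundle 𝓘(ℝ, E) Q) :
    ContMDiffAt 𝓘(ℝ, E).tangent 𝓘(ℝ, E).tangent ∞
      (fun v ↦ (⟨v.proj, S.drift v⟩ : TangentBundle 𝓘(ℝ, E) Q)) v :=
  S.metric.contMDiffAt_sharp S.externalForce_smooth.contMDiffAt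

theorem contMDiffAt_inputField (a : Fin m) (q : Q) :
    ContMDiffAt 𝓘(ℝ, E) 𝓘(ℝ, E).tangent ∞
      (fun q ↦ (⟨q, S.inputField a q⟩ : TangentBundle 𝓘(ℝ, E) Q)) q :=
  S.metric.contMDiffAt_sharp (contMDiffOn_univ.1 (S.controlForce_smooth a)).contMDiffAt

theorem contMDiffAt_acceleration {u : TangentBundle 𝓘(ℝ, E) Q → Fin m → ℝ}
    {v : TangentBundle 𝓘(ℝ, E) Q} (hu : ContMDiffAt 𝓘(ℝ, E).tangent 𝓘(ℝ, Fin m → ℝ) ∞ u v) :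
    ContMDiffAt 𝓘(ℝ, E).tangent 𝓘(ℝ, E).tangent ∞
      (fun v ↦ (⟨v.proj, S.acceleration v (u v)⟩ : TangentBundle 𝓘(ℝ, E) Q)) v := by
  obtain ⟨hπ, hd⟩ := contMDiffAt_tangentBundle_iff.1 (S.contMDiffAt_drift v)
  refine contMDiffAt_tangentBundle_iff.2 ⟨hπ, ?_⟩
  have hy : ∀ a, ContMDiffAt 𝓘(ℝ, E).tangent 𝓘(ℝ, E) ∞ (fun z : TangentBundle 𝓘(ℝ, E) Q ↦
      tangentCoordChange 𝓘(ℝ, E) z.proj v.proj z.proj (S.inputField a z.proj)) v := fun a ↦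
    (contMDiffAt_tangentBundle_iff.1
      (ContMDiffAt.comp (g := fun q ↦ (⟨q, S.inputField a q⟩ : TangentBundle 𝓘(ℝ, E) Q)) v
        (S.contMDiffAt_inputField a v.proj) hπ)).2
  have hua : ∀ a, ContMDiffAt 𝓘(ℝ, E).tangent 𝓘(ℝ) ∞ (fun z ↦ u z a) v :=
    contMDiffAt_pi_space.1 hu
  have hs := hd.add (ContMDiffAt.sum (t := Finset.univ) fun a _ ↦ (hua a).smul (hy a))
  refine hs.congr_of_eventuallyEq (Filter.Eventually.of_forall fun z ↦ ?_)
  let d : E := S.drift z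
  let y : Fin m → E := fun a ↦ S.inputField a z.proj
  change tangentCoordChange 𝓘(ℝ, E) z.proj v.proj z.proj (d + ∑ a, u z a • y a) =
    tangentCoordChange 𝓘(ℝ, E) z.proj v.proj z.proj d +
      ∑ a, u z a • tangentCoordChange 𝓘(ℝ, E) z.proj v.proj z.proj (y a)
  simp only [map_add, map_sum, map_smul]

theorem contMDiffAt_closedLoopField {u : TangentBundle 𝓘(ℝ, E) Q → Fin m → ℝ}
    {v : TangentBundle 𝓘(ℝ, E) Q} (hu : ContMDiffAt 𝓘(ℝ, E).tangent 𝓘(ℝ, Fin m → ℝ) ∞ u v) :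
    ContMDiffAt 𝓘(ℝ, E).tangent 𝓘(ℝ, E).tangent.tangent ∞
      (fun v ↦ (⟨v, S.closedLoopField u v⟩ :
        TangentBundle 𝓘(ℝ, E).tangent (TangentBundle 𝓘(ℝ, E) Q))) v := by
  simp only [closedLoopField, controlledVector_eq]
  exact contMDiffAt_secondOrderField S.metric le_rfl (S.contMDiffAt_acceleration hu)

theorem closedLoopField_eq (u : TangentBundle 𝓘(ℝ, E) Q → Fin m → ℝ)
    (v : TangentBundle 𝓘(ℝ, E) Q) :
    S.closedLoopField u v =
      (((v.snd : E), (-(show E from S.metric.christoffel v.proj v.snd v.snd) +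
        (show E from S.acceleration v (u v)))) : E × E) := by
  rw [closedLoopField, controlledVector_eq, verticalLift_eq]
  exact Prod.ext (add_zero (show E from v.snd)) rfl

/-- The base curve of an integral curve is differentiable, with the integral curve as velocity. -/
theorem hasMFDerivAt_proj {u : TangentBundle 𝓘(ℝ, E) Q → Fin m → ℝ}
    {c : ℝ → TangentBundle 𝓘(ℝ, E) Q} {t : ℝ}
    (h : HasMFDerivAt 𝓘(ℝ, ℝ) 𝓘(ℝ, E).tangent c t
      ((1 : ℝ →L[ℝ] ℝ).smulRight (S.closedLoopField u (c t)))) :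
    HasMFDerivAt 𝓘(ℝ, ℝ) 𝓘(ℝ, E) (fun s ↦ (c s).proj) t
      ((1 : ℝ →L[ℝ] ℝ).smulRight (c t).snd) := by
  obtain ⟨hc, hd⟩ := hasMFDerivAt_curve_iff.1 h
  refine hasMFDerivAt_curve_iff.2 ⟨?_, ?_⟩
  · exact (FiberBundle.continuous_proj E (TangentSpace 𝓘(ℝ, E))).continuousAt.comp hc
  · rw [closedLoopField_eq] at hd
    exact (hasFDerivAt_fst (𝕜 := ℝ) (E := E) (F := E)).comp_hasDerivAt t hd

/-- In the bundle chart the first component of the equation says that the fibre part is the velocity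
of the base curve, and the second says `ẍ = -Γ(ẋ, ẋ) + a`. Openness of `J` makes the first identity
hold near `t`, so that it can be differentiated. -/
theorem isMIntegralCurveOn_closedLoopField_iff (u : TangentBundle 𝓘(ℝ, E) Q → Fin m → ℝ)
    {J : Set ℝ} (hJ : IsOpen J) (c : ℝ → TangentBundle 𝓘(ℝ, E) Q) :
    IsMIntegralCurveOn c (S.closedLoopField u) J ↔
      ∃ q : ℝ → Q, S.IsTrajectoryOn u q J ∧ ∀ t ∈ J, c t = ⟨q t, velocity q t⟩ := by
  constructor
  · intro h
    have h' : ∀ t ∈ J, HasMFDerivAt 𝓘(ℝ, ℝ) 𝓘(ℝ, E).tangent c t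
      ((1 : ℝ →L[ℝ] ℝ).smulRight (S.closedLoopField u (c t))) := fun t ht ↦
      (h t ht).hasMFDerivAt (hJ.mem_nhds ht)
    let q : ℝ → Q := fun s ↦ (c s).proj
    have hq : ∀ t ∈ J, HasMFDerivAt 𝓘(ℝ, ℝ) 𝓘(ℝ, E) q t
      ((1 : ℝ →L[ℝ] ℝ).smulRight (c t).snd) := fun t ht ↦ S.hasMFDerivAt_proj (h' t ht)
    have hv : ∀ t ∈ J, velocity (E := E) q t = (c t).snd := fun t ht ↦
      velocity_eq_of_hasMFDerivAt (hq t ht)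
    have hcq : ∀ t ∈ J, c t = ⟨q t, velocity q t⟩ := fun t ht ↦ by
      rw [hv t ht]
    refine ⟨q, fun t ht ↦ ⟨(hq t ht).mdifferentiableAt, ?_⟩, hcq⟩
    obtain ⟨hc, hd⟩ := hasMFDerivAt_curve_iff.1 (h' t ht)
    rw [closedLoopField_eq] at hd
    have hd2 := (hasFDerivAt_snd (𝕜 := ℝ) (E := E) (F := E)).comp_hasDerivAt t hd
    refine ⟨_, hd2.congr_of_eventuallyEq ?_, ?_⟩
    · have hsrc : ∀ᶠ s in 𝓝 t, q s ∈ (extChartAt 𝓘(ℝ, E) (q t)).source :=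
        (hq t ht).continuousAt.preimage_mem_nhds (extChartAt_source_mem_nhds _)
      filter_upwards [hJ.mem_nhds ht, hsrc] with s hs hss
      rw [(hasDerivAt_extChartAt_curve (hq s hs).mdifferentiableAt hss).deriv, hv s hs]
      rfl
    · rw [← hcq t ht, hv t ht]
      let a : E := S.acceleration (c t) (u (c t))
      let Γ : E := S.metric.christoffel (c t).proj (c t).snd (c t).snd
      change a = (-Γ + a) + Γ
      abel
  · rintro ⟨q, hq, hcq⟩ t ht
    let c' : ℝ → TangentBundle 𝓘(ℝ, E) Q := fun s ↦ ⟨q s, velocity q s⟩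
    obtain ⟨hqt, y, hy, hw⟩ := hq t ht
    have hcc : c =ᶠ[𝓝 t] c' := by
      filter_upwards [hJ.mem_nhds ht] with s hs using hcq s hs
    have hsrc : ∀ᶠ s in 𝓝 t, q s ∈ (extChartAt 𝓘(ℝ, E) (q t)).source :=
      hqt.continuousAt.preimage_mem_nhds (extChartAt_source_mem_nhds _)
    have hvel : ∀ᶠ s in 𝓝 t, tangentCoordChange 𝓘(ℝ, E) (q s) (q t) (q s) (velocity q s) =
        deriv (fun r ↦ extChartAt 𝓘(ℝ, E) (q t) (q r)) s := by
      filter_upwards [hJ.mem_nhds ht, hsrc] with s hs hss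
      exact (hasDerivAt_extChartAt_curve (hq s hs).1 hss).deriv.symm
    have hc' : ContinuousAt c' t := by
      refine (FiberBundle.continuousAt_totalSpace E c').2 ⟨hqt.continuousAt, ?_⟩
      exact hy.continuousAt.congr (hvel.mono fun s hs ↦ hs.symm)
    have hx : HasDerivAt (fun s ↦ extChartAt 𝓘(ℝ, E) (q t) (q s))
        (show E from velocity (E := E) q t) t :=
      (hasMFDerivAt_curve_iff.1 (velocity_hasMFDerivAt hqt)).2
    have hd : HasDerivAt (F := E × E) (fun s ↦ extChartAt 𝓘(ℝ, E).tangent (c' t) (c' s))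
        (S.closedLoopField u (c' t)) t := by
      have e : S.closedLoopField u (c' t) =
          (((show E from velocity (E := E) q t), y) : E × E) := by
        rw [closedLoopField_eq]
        let a : E := S.acceleration (c' t) (u (c' t))
        let Γ : E := S.metric.christoffel (q t) (velocity q t) (velocity q t)
        have hw' : a = y + Γ := hw
        refine Prod.ext rfl ?_
        change -Γ + a = y
        rw [hw']
        abel
      rw [e]
      refine (hx.prodMk hy).congr_of_eventuallyEq ?_
      filter_upwards [hvel] with s hs
      exact Prod.ext rfl hs
    -- The chart and the type of the tangent vector depend on the base point, and `c t = c' t` is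
    -- only a propositional equality; hence the quantified `z`.
    have hd' : ∀ z, z = c' t → HasDerivAt (F := E × E)
        (fun s ↦ extChartAt 𝓘(ℝ, E).tangent z (c s)) (S.closedLoopField u z) t := by
      rintro _ rfl
      exact hd.congr_of_eventuallyEq (hcc.mono fun s hs ↦ congrArg _ hs)
    exact (hasMFDerivAt_curve_iff.2 ⟨hc'.congr hcc.symm, hd' (c t) (hcq t ht)⟩).hasMFDerivWithinAt

end MechanicalControlSystem

/-! ### Smoothness of contractions, differentials and determinants. -/

section OneForms

variable {E : Type*} [NormedAddCommGroup E] [NormedSpace ℝ E]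
  {Q : Type*} [TopologicalSpace Q] [ChartedSpace E Q] [IsManifold 𝓘(ℝ, E) ∞ Q]

theorem OneForm.SmoothOn.contMDiffAt_apply {EM : Type*} [NormedAddCommGroup EM] [NormedSpace ℝ EM]
    {HM : Type*} [TopologicalSpace HM] {IM : ModelWithCorners ℝ EM HM}
    {M : Type*} [TopologicalSpace M] [ChartedSpace HM M] {b : M → Q}
    {w : ∀ x, TangentSpace 𝓘(ℝ, E) (b x)} {x₀ : M} {α : OneForm E Q} {U : Set Q}
    (hα : α.SmoothOn U) (hU : IsOpen U) (hx : b x₀ ∈ U)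
    (hw : ContMDiffAt IM 𝓘(ℝ, E).tangent ∞ (fun x ↦ (⟨b x, w x⟩ : TangentBundle 𝓘(ℝ, E) Q)) x₀) :
    ContMDiffAt IM 𝓘(ℝ) ∞ (fun x ↦ α (b x) (w x)) x₀ := by
  have hb := (contMDiffAt_tangentBundle_iff.1 hw).1
  have : ContMDiffAt IM (𝓘(ℝ, E).prod 𝓘(ℝ)) ∞
      (fun m ↦ TotalSpace.mk' ℝ (E := Bundle.Trivial Q ℝ) (b m) (α (b m) (w m))) x₀ := by
    apply ContMDiffAt.clm_bundle_apply (F₁ := E)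
    · exact ContMDiffAt.comp x₀ (ContMDiffOn.contMDiffAt hα (hU.mem_nhds hx)) hb
    · exact hw
  exact (contMDiffAt_totalSpace.1 this).2

/-- `df(W)` is the fibre component of the tangent map of `f` composed with the section `W`. -/
theorem contMDiffAt_mfderiv_apply {EM : Type*} [NormedAddCommGroup EM] [NormedSpace ℝ EM]
    {HM : Type*} [TopologicalSpace HM] {IM : ModelWithCorners ℝ EM HM}
    {M : Type*} [TopologicalSpace M] [ChartedSpace HM M] [IsManifold IM 1 M]
    {f : M → ℝ} {W : ∀ x, TangentSpace IM x} {s : Set M} (hs : IsOpen s) {x₀ : M} (hx : x₀ ∈ s)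
    (hf : ContMDiffOn IM 𝓘(ℝ) ∞ f s)
    (hW : ContMDiffAt IM IM.tangent ∞ (fun x ↦ (⟨x, W x⟩ : TangentBundle IM M)) x₀) :
    ContMDiffAt IM 𝓘(ℝ) ∞ (fun x ↦ (mfderiv IM 𝓘(ℝ) f x (W x) : ℝ)) x₀ := by
  have h1 := hf.contMDiffOn_tangentMapWithin (m := ∞) (by simp) hs.uniqueMDiffOn
  have hs' : IsOpen (TotalSpace.proj ⁻¹' s : Set (TangentBundle IM M)) :=
    hs.preimage (FiberBundle.continuous_proj EM (TangentSpace IM))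
  have h2 := (h1.contMDiffAt (x := (⟨x₀, W x₀⟩ : TangentBundle IM M))
    (hs'.mem_nhds hx)).comp x₀ hW
  have h3 := ((contMDiff_snd_tangentBundle_modelSpace ℝ 𝓘(ℝ)).contMDiffAt).comp x₀ h2
  refine h3.congr_of_eventuallyEq ?_
  filter_upwards [hs.mem_nhds hx] with x hxs
  exact congrArg (fun L : TangentSpace IM x →L[ℝ] ℝ ↦ L (W x)) (mfderivWithin_of_isOpen hs hxs).symm

theorem contMDiffAt_det {EM : Type*} [NormedAddCommGroup EM] [NormedSpace ℝ EM]
    {HM : Type*} [TopologicalSpace HM] {IM : ModelWithCorners ℝ EM HM}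
    {M : Type*} [TopologicalSpace M] [ChartedSpace HM M] {n : ℕ∞ω} {ι : Type*} [Fintype ι]
    [DecidableEq ι] {B : M → Matrix ι ι ℝ} {x₀ : M}
    (hB : ∀ i j, ContMDiffAt IM 𝓘(ℝ) n (fun x ↦ B x i j) x₀) :
    ContMDiffAt IM 𝓘(ℝ) n (fun x ↦ (B x).det) x₀ := by
  simp only [Matrix.det_apply']
  exact ContMDiffAt.sum fun σ _ ↦ contMDiffAt_const.mul (contMDiffAt_finsetProd fun i _ ↦ hB _ _)

end OneForms

/-! ### Topology of `TQ` required for partitions of unity. -/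

section Topology

variable {E : Type*} [NormedAddCommGroup E] [NormedSpace ℝ E]
  {Q : Type*} [TopologicalSpace Q] [ChartedSpace E Q] [IsManifold 𝓘(ℝ, E) ∞ Q]

/-- Points over different base points are separated in `Q`; points of one fibre lie in a common
chart. -/
instance TangentBundle.t2Space [T2Space Q] : T2Space (TangentBundle 𝓘(ℝ, E) Q) where
  t2 v w hne := by
    by_cases hp : v.proj = w.proj
    · let e := chartAt (ModelProd E E) v
      have hv : v ∈ e.source := mem_chart_source _ v
      have hw : w ∈ e.source := by
        rw [TangentBundle.mem_chart_source_iff, ← hp]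
        exact mem_chart_source E v.proj
      have : T2Space (ModelProd E E) := inferInstanceAs (T2Space (E × E))
      obtain ⟨V, W, hV, hW, hvV, hwW, hVW⟩ := t2_separation fun h ↦ hne (e.injOn hv hw h)
      exact ⟨_, _, e.isOpen_inter_preimage hV, e.isOpen_inter_preimage hW, ⟨hv, hvV⟩, ⟨hw, hwW⟩,
        (hVW.preimage e).mono inter_subset_right inter_subset_right⟩
    · obtain ⟨V, W, hV, hW, hvV, hwW, hVW⟩ := t2_separation hp
      have hπ := FiberBundle.continuous_proj E (TangentSpace 𝓘(ℝ, E) : Q → Type _)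
      exact ⟨_, _, hV.preimage hπ, hW.preimage hπ, hvV, hwW, hVW.preimage _⟩

instance TangentBundle.sigmaCompactSpace [FiniteDimensional ℝ E] [SecondCountableTopology Q] :
    SigmaCompactSpace (TangentBundle 𝓘(ℝ, E) Q) := by
  have := FiniteDimensional.proper ℝ E
  have : SecondCountableTopology (ModelProd E E) :=
    inferInstanceAs (SecondCountableTopology (E × E))
  have : LocallyCompactSpace (ModelProd E E) := inferInstanceAs (LocallyCompactSpace (E × E))
  obtain ⟨s, hs, hcov⟩ := TopologicalSpace.countable_cover_nhds (chart_source_mem_nhds E (M := Q))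
  have : SecondCountableTopology (TangentBundle 𝓘(ℝ, E) Q) := by
    refine ChartedSpace.secondCountable_of_countable_cover (ModelProd E E)
      (s := (fun q : Q ↦ (⟨q, 0⟩ : TangentBundle 𝓘(ℝ, E) Q)) '' s) ?_ (hs.image _)
    refine eq_univ_of_forall fun v ↦ ?_
    obtain ⟨q, hq, hv⟩ := mem_iUnion₂.1 (hcov ▸ mem_univ v.proj)
    exact mem_iUnion₂.2 ⟨_, mem_image_of_mem _ hq, (TangentBundle.mem_chart_source_iff _ _).2 hv⟩
  have : LocallyCompactSpace (TangentBundle 𝓘(ℝ, E) Q) :=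
    ChartedSpace.locallyCompactSpace (ModelProd E E) _
  infer_instance

end Topology

/-! ### Constraint functions, tangency to `𝒜`, and the linear system for the control. -/

namespace AffineDistribution

variable {E : Type*} [NormedAddCommGroup E] [NormedSpace ℝ E]
  {Q : Type*} [TopologicalSpace Q] [ChartedSpace E Q] [IsManifold 𝓘(ℝ, E) ∞ Q] {m : ℕ}
  (A : AffineDistribution E Q m)

theorem mem_carrier_iff {U : Set Q} {μ : Fin m → OneForm E Q} (hμ : IsAnnihilatorOn A.D U μ)
    {v : TangentBundle 𝓘(ℝ, E) Q} (hv : v.proj ∈ U) :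
    v ∈ A.carrier ↔ ∀ b, A.constraint (μ b) v = 0 := by
  have h : v ∈ A.carrier ↔ v.snd - A.X v.proj ∈ A.D v.proj :=
    AffineSubspace.mem_mk' (p := A.X v.proj) (direction := A.D v.proj) (q := v.snd)
  rw [h, hμ.mem_iff _ hv]
  simp only [map_sub]
  rfl

theorem contMDiffAt_constraint {U : Set Q} (hU : IsOpen U) {α : OneForm E Q} (hα : α.SmoothOn U)
    {v : TangentBundle 𝓘(ℝ, E) Q} (hv : v.proj ∈ U) :
    ContMDiffAt 𝓘(ℝ, E).tangent 𝓘(ℝ) ∞ (A.constraint α) v := by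
  have hπ : ContMDiffAt 𝓘(ℝ, E).tangent 𝓘(ℝ, E) ∞
      (TotalSpace.proj : TangentBundle 𝓘(ℝ, E) Q → Q) v :=
    (contMDiffAt_tangentBundle_iff.1 (contMDiffAt_id (x := v))).1
  have h1 := hα.contMDiffAt_apply hU (b := TotalSpace.proj) (w := fun v ↦ v.snd) hv
    (contMDiffAt_id (x := v))
  have h2 := (hα.contMDiffAt_apply hU (b := id) (w := A.X) hv
    (A.X_smooth v.proj)).comp v hπ
  exact h1.sub h2

theorem mdifferentiableAt_constraint {U : Set Q} (hU : IsOpen U) {α : OneForm E Q}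
    (hα : α.SmoothOn U) {v : TangentBundle 𝓘(ℝ, E) Q} (hv : v.proj ∈ U) :
    MDifferentiableAt 𝓘(ℝ, E).tangent 𝓘(ℝ) (A.constraint α) v :=
  (A.contMDiffAt_constraint hU hα hv).mdifferentiableAt (by simp)

/-- Along `v + t w` the constraint function is affine in `t` with slope `α(w)`. -/
theorem mfderiv_constraint_verticalLift {U : Set Q} (hU : IsOpen U) {α : OneForm E Q}
    (hα : α.SmoothOn U) {v : TangentBundle 𝓘(ℝ, E) Q} (hv : v.proj ∈ U)
    (w : TangentSpace 𝓘(ℝ, E) v.proj) :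
    (mfderiv 𝓘(ℝ, E).tangent 𝓘(ℝ) (A.constraint α) v (verticalLift v w) : ℝ) =
      α v.proj w := by
  let c : ℝ → TangentBundle 𝓘(ℝ, E) Q := fun t ↦ ⟨v.proj, v.snd + t • w⟩
  have hc0 : c 0 = v := by
    change (⟨v.proj, v.snd + (0 : ℝ) • w⟩ : TangentBundle 𝓘(ℝ, E) Q) = v
    rw [zero_smul, add_zero]
  have key : ∀ z, z = c 0 →
      (mfderiv 𝓘(ℝ, E).tangent 𝓘(ℝ) (A.constraint α) z : E × E →L[ℝ] ℝ) (verticalLift v w) =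
        α v.proj w := by
    rintro _ rfl
    have h := HasMFDerivAt.comp (g := A.constraint α) 0
      (A.mdifferentiableAt_constraint hU hα (v := c 0) hv).hasMFDerivAt
      (hasMFDerivAt_vertical v w)
    have h2 : HasDerivAt (fun t : ℝ ↦ A.constraint α (c t)) (α v.proj w) 0 := by
      have e : ∀ t : ℝ, A.constraint α (c t) =
          α v.proj v.snd + t * α v.proj w - α v.proj (A.X v.proj) := fun t ↦ by
        change α v.proj (v.snd + t • w) - _ = _
        rw [map_add, map_smul, smul_eq_mul]
      simp only [e]
      simpa using (((hasDerivAt_id (0 : ℝ)).mul_const (α v.proj w)).const_add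
        (α v.proj v.snd)).sub_const (α v.proj (A.X v.proj))
    have h3 := congrArg (fun L : ℝ →L[ℝ] ℝ ↦ L 1) (hasMFDerivAt_unique h h2.hasFDerivAt.hasMFDerivAt)
    refine Eq.trans ?_ (h3.trans (one_mul _))
    rw [verticalLift_eq]
    exact congrArg (mfderiv 𝓘(ℝ, E).tangent 𝓘(ℝ) (A.constraint α) (c 0) : E × E →L[ℝ] ℝ)
      (one_smul ℝ ((0, (w : E)) : E × E)).symm
  exact key v hc0.symm

/-- Curves in `𝒜` have velocities annihilated by the differentials of the constraint functions. -/
theorem mfderiv_constraint_of_curve {U : Set Q} (hU : IsOpen U) {μ : Fin m → OneForm E Q}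
    (hμ : IsAnnihilatorOn A.D U μ) {c : ℝ → TangentBundle 𝓘(ℝ, E) Q} {t : ℝ}
    {w : TangentSpace 𝓘(ℝ, E).tangent (c t)} (hct : (c t).proj ∈ U)
    (hc : ∀ᶠ s in 𝓝 t, c s ∈ A.carrier)
    (h : HasMFDerivAt 𝓘(ℝ, ℝ) 𝓘(ℝ, E).tangent c t ((1 : ℝ →L[ℝ] ℝ).smulRight w)) (b : Fin m) :
    (mfderiv 𝓘(ℝ, E).tangent 𝓘(ℝ) (A.constraint (μ b)) (c t) w : ℝ) = 0 := by
  have hd := HasMFDerivAt.comp (g := A.constraint (μ b)) t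
    (A.mdifferentiableAt_constraint hU (hμ.smooth b) hct).hasMFDerivAt h
  have hcU : ∀ᶠ s in 𝓝 t, (c s).proj ∈ U :=
    ((FiberBundle.continuous_proj E (TangentSpace 𝓘(ℝ, E))).continuousAt.comp
      h.continuousAt).preimage_mem_nhds (hU.mem_nhds hct)
  have h0 : HasFDerivAt (fun s ↦ A.constraint (μ b) (c s)) (0 : ℝ →L[ℝ] ℝ) t := by
    refine (hasFDerivAt_const (0 : ℝ) t).congr_of_eventuallyEq ?_
    filter_upwards [hc, hcU] with s hs hsU using (A.mem_carrier_iff hμ hsU).1 hs b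
  have h3 := congrArg (fun L : ℝ →L[ℝ] ℝ ↦ L 1) (hasMFDerivAt_unique hd h0.hasMFDerivAt)
  refine Eq.trans ?_ h3
  exact congrArg (mfderiv 𝓘(ℝ, E).tangent 𝓘(ℝ) (A.constraint (μ b)) (c t) : E × E →L[ℝ] ℝ)
    (one_smul ℝ (show E × E from w)).symm

theorem mfderiv_constraint_of_isTangentAt {U : Set Q} (hU : IsOpen U) {μ : Fin m → OneForm E Q}
    (hμ : IsAnnihilatorOn A.D U μ) {v : TangentBundle 𝓘(ℝ, E) Q}
    {w : TangentSpace 𝓘(ℝ, E).tangent v} (hv : v.proj ∈ U) (h : A.IsTangentAt v w) (b : Fin m) :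
    (mfderiv 𝓘(ℝ, E).tangent 𝓘(ℝ) (A.constraint (μ b)) v w : ℝ) = 0 := by
  obtain ⟨c, hc, hd, heq⟩ := h
  have hv' : c 0 = v := congrArg TotalSpace.proj heq
  subst hv'
  obtain rfl : _ = w := eq_of_heq (TotalSpace.mk.inj heq).2
  refine A.mfderiv_constraint_of_curve hU hμ hv hc ?_ b
  have e : (mfderiv 𝓘(ℝ, ℝ) 𝓘(ℝ, E).tangent c 0 : ℝ →L[ℝ] E × E) =
      (1 : ℝ →L[ℝ] ℝ).smulRight
        ((mfderiv 𝓘(ℝ, ℝ) 𝓘(ℝ, E).tangent c 0 : ℝ →L[ℝ] E × E) 1) := by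
    exact ContinuousLinearMap.ext_ring (one_smul ℝ _).symm
  exact e ▸ hd.hasMFDerivAt

theorem isTangentAt_of_curve {c : ℝ → TangentBundle 𝓘(ℝ, E) Q}
    {v : TangentBundle 𝓘(ℝ, E) Q} (hv : c 0 = v)
    {W : ∀ v : TangentBundle 𝓘(ℝ, E) Q, TangentSpace 𝓘(ℝ, E).tangent v}
    (hc : ∀ᶠ s in 𝓝 (0 : ℝ), c s ∈ A.carrier)
    (h : HasMFDerivAt 𝓘(ℝ, ℝ) 𝓘(ℝ, E).tangent c 0 ((1 : ℝ →L[ℝ] ℝ).smulRight (W (c 0)))) :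
    A.IsTangentAt v (W v) := by
  subst hv
  refine ⟨c, hc, h.mdifferentiableAt, ?_⟩
  have e : (mfderiv 𝓘(ℝ, ℝ) 𝓘(ℝ, E).tangent c 0 : ℝ →L[ℝ] E × E) 1 = W (c 0) :=
    (congrArg (fun L : ℝ →L[ℝ] E × E ↦ L 1) h.mfderiv).trans (one_smul ℝ (W (c 0) : E × E))
  exact congrArg (TotalSpace.mk (c 0)) e

theorem isClosed_carrier : IsClosed A.carrier := by
  rw [← isOpen_compl_iff, isOpen_iff_mem_nhds]
  intro v hv
  obtain ⟨U, hU, hvU, μ, hμ⟩ := A.D_regular v.proj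
  have h := mt (A.mem_carrier_iff hμ hvU).2 hv
  push Not at h
  obtain ⟨b, hb⟩ := h
  filter_upwards [(A.contMDiffAt_constraint hU (hμ.smooth b) hvU).continuousAt.eventually_ne hb,
    (hU.preimage (FiberBundle.continuous_proj E (TangentSpace 𝓘(ℝ, E)))).mem_nhds hvU]
    with z hz hzU hzA
  exact hz ((A.mem_carrier_iff hμ hzU).1 hzA b)

variable [FiniteDimensional ℝ E] (S : MechanicalControlSystem E Q m)

/-- A left null vector `l` of `P` gives `L = ∑ l_b μ^b`, which vanishes on `ℱ` by the choice of `l`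
and on `𝒟` by definition. Transversality then forces `L = 0`, and independence of the `μ^b` gives `l
= 0`. -/
theorem isUnit_controlMatrix (hA : A.TransversalToInputs S) {U : Set Q}
    {μ : Fin m → OneForm E Q} (hμ : IsAnnihilatorOn A.D U μ) {q : Q} (hq : q ∈ U) :
    IsUnit (controlMatrix S μ q) := by
  rw [← Matrix.vecMul_injective_iff_isUnit]
  refine (injective_iff_map_eq_zero (Matrix.vecMulLinear (controlMatrix S μ q))).2 fun l hl ↦ ?_
  have hY : ∀ a, ∑ b, l b * μ b q (S.inputField a q) = 0 := fun a ↦ congrFun hl a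
  let L : TangentSpace 𝓘(ℝ, E) q →L[ℝ] ℝ := ∑ b, l b • μ b q
  have hL : ∀ w, L w = ∑ b, l b * μ b q w := fun w ↦ by
    simp [L]
  have hF : ∀ w ∈ S.inputDistribution q, L w = 0 := by
    intro w hw
    have : S.inputDistribution q ≤ LinearMap.ker L.toLinearMap :=
      Submodule.span_le.2 (range_subset_iff.2 fun a ↦ (hL _).trans (hY a))
    exact this hw
  have hL0 : L = 0 := by
    ext w
    -- The affine fibre is offset by `X(q)`, so it is `X(q) + w` that is decomposed as `x + f`; this
    -- leaves `w = (x - X(q)) + f` with `x - X(q)` in `𝒟`.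
    have hw : A.X q + w ∈ ((A.fiber q : Set (TangentSpace 𝓘(ℝ, E) q)) +
        ((S.inputDistribution q).toAffineSubspace : Set (TangentSpace 𝓘(ℝ, E) q))) :=
      (hA q).1 ▸ mem_univ _
    obtain ⟨x, hx, f, hf, hxf⟩ := Set.mem_add.1 hw
    have hx' : x - A.X q ∈ A.D q := AffineSubspace.mem_mk'.1 hx
    have hxL : L (x - A.X q) = 0 := by
      rw [hL]
      exact Finset.sum_eq_zero fun b _ ↦ by rw [(hμ.mem_iff q hq _).1 hx' b, mul_zero]
    have : w = (x - A.X q) + f := by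
      rw [sub_add_eq_add_sub, hxf]; abel
    rw [this, map_add, hxL, hF f hf]
    simp
  exact funext (Fintype.linearIndependent_iff.1 (hμ.independent q hq) l hL0)

/-- The linear system for the control values says that the controlled vector annihilates the
constraint functions. -/
theorem mfderiv_constraint_controlledVector {U : Set Q} (hU : IsOpen U)
    {μ : Fin m → OneForm E Q} (hμ : IsAnnihilatorOn A.D U μ) {v : TangentBundle 𝓘(ℝ, E) Q}
    (hv : v.proj ∈ U) (τ : Fin m → ℝ) (b : Fin m) :
    (mfderiv 𝓘(ℝ, E).tangent 𝓘(ℝ) (A.constraint (μ b)) v (S.controlledVector v τ) : ℝ) =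
      (controlMatrix S μ v.proj).mulVec τ b - A.controlRhs S μ v b := by
  have h := fun a ↦ A.mfderiv_constraint_verticalLift hU (hμ.smooth b) hv (S.inputField a v.proj)
  let L : TangentSpace 𝓘(ℝ, E).tangent v →L[ℝ] ℝ :=
    mfderiv 𝓘(ℝ, E).tangent 𝓘(ℝ) (A.constraint (μ b)) v
  have h' : ∀ a, L (verticalLift v (S.inputField a v.proj)) = μ b v.proj (S.inputField a v.proj) :=
    h
  change L (S.unactuatedField v + ∑ a, τ a • verticalLift v (S.inputField a v.proj)) =
    (∑ a, μ b v.proj (S.inputField a v.proj) * τ a) - (-(L (S.unactuatedField v)))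
  rw [map_add, map_sum, sub_neg_eq_add, add_comm]
  refine congrArg (· + _) (Finset.sum_congr rfl fun a _ ↦ ?_)
  rw [map_smul, h', smul_eq_mul, mul_comm]

theorem mulVec_eq_controlRhs_of_isTangentAt {U : Set Q} (hU : IsOpen U)
    {μ : Fin m → OneForm E Q} (hμ : IsAnnihilatorOn A.D U μ) {v : TangentBundle 𝓘(ℝ, E) Q}
    (hv : v.proj ∈ U) {τ : Fin m → ℝ} (h : A.IsTangentAt v (S.controlledVector v τ)) :
    (controlMatrix S μ v.proj).mulVec τ = A.controlRhs S μ v := by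
  funext b
  have := A.mfderiv_constraint_of_isTangentAt hU hμ hv h b
  rw [A.mfderiv_constraint_controlledVector S hU hμ hv] at this
  exact sub_eq_zero.1 this

/-- At most one control value makes the controlled vector tangent to `𝒜`. -/
theorem eq_of_isTangentAt (hA : A.TransversalToInputs S) {v : TangentBundle 𝓘(ℝ, E) Q}
    {τ τ' : Fin m → ℝ} (h : A.IsTangentAt v (S.controlledVector v τ))
    (h' : A.IsTangentAt v (S.controlledVector v τ')) : τ = τ' := by
  obtain ⟨U, hU, hv, μ, hμ⟩ := A.D_regular v.proj
  refine Matrix.mulVec_injective_iff_isUnit.2 (A.isUnit_controlMatrix S hA hμ hv) ?_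
  rw [A.mulVec_eq_controlRhs_of_isTangentAt S hU hμ hv h,
    A.mulVec_eq_controlRhs_of_isTangentAt S hU hμ hv h']

end AffineDistribution

/-! ### The local feedback of Cramer's rule, its globalisation, and invariance. -/

namespace AffineDistribution

variable {E : Type*} [NormedAddCommGroup E] [NormedSpace ℝ E] [FiniteDimensional ℝ E]
  {Q : Type*} [TopologicalSpace Q] [ChartedSpace E Q] [IsManifold 𝓘(ℝ, E) ∞ Q] {m : ℕ}
  (A : AffineDistribution E Q m) (S : MechanicalControlSystem E Q m)

/-- The solution of the linear system for the control values, by Cramer's rule. -/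
def cramerFeedback (μ : Fin m → OneForm E Q) (v : TangentBundle 𝓘(ℝ, E) Q) : Fin m → ℝ :=
  (controlMatrix S μ v.proj).det⁻¹ • (controlMatrix S μ v.proj).cramer (A.controlRhs S μ v)

theorem mulVec_cramerFeedback (hA : A.TransversalToInputs S) {U : Set Q}
    {μ : Fin m → OneForm E Q} (hμ : IsAnnihilatorOn A.D U μ) {v : TangentBundle 𝓘(ℝ, E) Q}
    (hv : v.proj ∈ U) :
    (controlMatrix S μ v.proj).mulVec (A.cramerFeedback S μ v) = A.controlRhs S μ v := by
  have h := ((Matrix.isUnit_iff_isUnit_det _).1 (A.isUnit_controlMatrix S hA hμ hv)).ne_zero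
  rw [cramerFeedback, Matrix.mulVec_smul, Matrix.mulVec_cramer, smul_smul, inv_mul_cancel₀ h,
    one_smul]

/-- The entries of `P` and `b` are smooth, and Cramer's rule writes the solution as quotients of
determinants in them, with nonvanishing denominator `det P`. -/
theorem contMDiffAt_cramerFeedback (hA : A.TransversalToInputs S) {U : Set Q} (hU : IsOpen U)
    {μ : Fin m → OneForm E Q} (hμ : IsAnnihilatorOn A.D U μ) {v : TangentBundle 𝓘(ℝ, E) Q}
    (hv : v.proj ∈ U) :
    ContMDiffAt 𝓘(ℝ, E).tangent 𝓘(ℝ, Fin m → ℝ) ∞ (A.cramerFeedback S μ) v := by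
  have hdet := ((Matrix.isUnit_iff_isUnit_det _).1 (A.isUnit_controlMatrix S hA hμ hv)).ne_zero
  have hπ : ContMDiffAt 𝓘(ℝ, E).tangent 𝓘(ℝ, E) ∞
      (TotalSpace.proj : TangentBundle 𝓘(ℝ, E) Q → Q) v :=
    (contMDiffAt_tangentBundle_iff.1 (contMDiffAt_id (x := v))).1
  have hP : ∀ b a, ContMDiffAt 𝓘(ℝ, E).tangent 𝓘(ℝ) ∞
      (fun v : TangentBundle 𝓘(ℝ, E) Q ↦ controlMatrix S μ v.proj b a) v := fun b a ↦
    ((hμ.smooth b).contMDiffAt_apply hU (b := id) (w := S.inputField a) hv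
      (S.contMDiffAt_inputField a v.proj)).comp v hπ
  have hπU : IsOpen (TotalSpace.proj ⁻¹' U : Set (TangentBundle 𝓘(ℝ, E) Q)) :=
    hU.preimage (FiberBundle.continuous_proj E (TangentSpace 𝓘(ℝ, E)))
  have hG : ContMDiffAt 𝓘(ℝ, E).tangent 𝓘(ℝ, E).tangent.tangent ∞
      (fun v ↦ (⟨v, S.unactuatedField v⟩ :
        TangentBundle 𝓘(ℝ, E).tangent (TangentBundle 𝓘(ℝ, E) Q))) v :=
    contMDiffAt_secondOrderField S.metric le_rfl (S.contMDiffAt_drift v)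
  have hb : ∀ b, ContMDiffAt 𝓘(ℝ, E).tangent 𝓘(ℝ) ∞ (fun v ↦ A.controlRhs S μ v b) v := fun b ↦
    (contMDiffAt_mfderiv_apply hπU hv (fun z hz ↦
      (A.contMDiffAt_constraint hU (hμ.smooth b) hz).contMDiffWithinAt) hG).neg
  refine contMDiffAt_pi_space.2 fun a ↦ ?_
  refine ((contMDiffAt_det hP).inv₀ hdet).mul ?_
  simp only [Matrix.cramer_apply]
  refine contMDiffAt_det fun i j ↦ ?_
  by_cases hj : j = a
  · subst hj
    simpa only [Matrix.updateCol_self] using hb i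
  · simpa only [Matrix.updateCol_ne hj] using hP i j

/-- Integral curves for the feedback of Cramer's rule that start in `𝒜` stay in `𝒜`. -/
theorem eventually_mem_carrier_of_cramerFeedback (hA : A.TransversalToInputs S) {U : Set Q}
    (hU : IsOpen U) {μ : Fin m → OneForm E Q} (hμ : IsAnnihilatorOn A.D U μ)
    {c : ℝ → TangentBundle 𝓘(ℝ, E) Q} {t₀ : ℝ} (hcU : (c t₀).proj ∈ U) (hcA : c t₀ ∈ A.carrier)
    (hc : IsMIntegralCurveAt c (S.closedLoopField (A.cramerFeedback S μ)) t₀) :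
    ∀ᶠ t in 𝓝 t₀, c t ∈ A.carrier := by
  have hU' : ∀ᶠ t in 𝓝 t₀, (c t).proj ∈ U :=
    ((FiberBundle.continuous_proj E (TangentSpace 𝓘(ℝ, E))).continuousAt.comp
      hc.continuousAt).preimage_mem_nhds (hU.mem_nhds hcU)
  obtain ⟨ε, hε, hball⟩ := Metric.eventually_nhds_iff_ball.1 (hU'.and hc)
  refine Filter.eventually_of_mem (Metric.ball_mem_nhds t₀ hε) fun t ht ↦ ?_
  refine (A.mem_carrier_iff hμ (hball t ht).1).2 fun b ↦ ?_
  -- The system is solved at every point over `U`, not only on `𝒜`, so each constraint function is a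
  -- first integral; no prior knowledge that the curve lies in `𝒜` is used.
  have hd : ∀ s ∈ Metric.ball t₀ ε, HasDerivAt (fun s ↦ A.constraint (μ b) (c s)) 0 s := by
    intro s hs
    obtain ⟨hsU, hs'⟩ := hball s hs
    have h := (HasMFDerivAt.comp (g := A.constraint (μ b)) s
      (A.mdifferentiableAt_constraint hU (hμ.smooth b) hsU).hasMFDerivAt hs')
    have h0 : (mfderiv 𝓘(ℝ, E).tangent 𝓘(ℝ) (A.constraint (μ b)) (c s)
        (S.closedLoopField (A.cramerFeedback S μ) (c s)) : ℝ) = 0 := by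
      rw [MechanicalControlSystem.closedLoopField,
        A.mfderiv_constraint_controlledVector S hU hμ hsU,
        A.mulVec_cramerFeedback S hA hμ hsU]
      exact sub_self _
    refine hasDerivAt_iff_hasFDerivAt.2 (HasMFDerivAt.hasFDerivAt (h.congr_mfderiv ?_))
    refine ContinuousLinearMap.ext_ring ?_
    refine Eq.trans ?_ (h0.trans (smul_zero (1 : ℝ)).symm)
    exact congrArg (mfderiv 𝓘(ℝ, E).tangent 𝓘(ℝ) (A.constraint (μ b)) (c s) : E × E →L[ℝ] ℝ)
      (one_smul ℝ (show E × E from S.closedLoopField (A.cramerFeedback S μ) (c s)))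
  have hconst := Metric.isOpen_ball.is_const_of_deriv_eq_zero
    (convex_ball t₀ ε).isPreconnected
    (fun s hs ↦ (hd s hs).differentiableAt.differentiableWithinAt)
    (fun s hs ↦ (hd s hs).deriv) ht (Metric.mem_ball_self hε)
  exact hconst.trans ((A.mem_carrier_iff hμ hcU).1 hcA b)

theorem exists_integralCurve_cramerFeedback (hA : A.TransversalToInputs S) {U : Set Q}
    (hU : IsOpen U) {μ : Fin m → OneForm E Q} (hμ : IsAnnihilatorOn A.D U μ)
    {v : TangentBundle 𝓘(ℝ, E) Q} (hv : v.proj ∈ U) (hvA : v ∈ A.carrier) (t₀ : ℝ) :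
    ∃ c : ℝ → TangentBundle 𝓘(ℝ, E) Q, c t₀ = v ∧
      IsMIntegralCurveAt c (S.closedLoopField (A.cramerFeedback S μ)) t₀ ∧
      ∀ᶠ t in 𝓝 t₀, c t ∈ A.carrier := by
  obtain ⟨c, rfl, hc⟩ := exists_isMIntegralCurveAt_of_contMDiffAt_boundaryless t₀
    ((S.contMDiffAt_closedLoopField (A.contMDiffAt_cramerFeedback S hA hU hμ hv)).of_le
      (by norm_cast))
  exact ⟨c, rfl, hc, A.eventually_mem_carrier_of_cramerFeedback S hA hU hμ hv hvA hc⟩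

/-- The integral curve through `v` lies in `𝒜` for short times and so witnesses tangency, with no
appeal to the implicit function theorem. -/
theorem isTangentAt_cramerFeedback (hA : A.TransversalToInputs S) {U : Set Q}
    (hU : IsOpen U) {μ : Fin m → OneForm E Q} (hμ : IsAnnihilatorOn A.D U μ)
    {v : TangentBundle 𝓘(ℝ, E) Q} (hv : v.proj ∈ U) (hvA : v ∈ A.carrier) :
    A.IsTangentAt v (S.controlledVector v (A.cramerFeedback S μ v)) := by
  obtain ⟨c, hcv, hc, hcA⟩ := A.exists_integralCurve_cramerFeedback S hA hU hμ hv hvA 0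
  exact A.isTangentAt_of_curve hcv (W := S.closedLoopField (A.cramerFeedback S μ)) hcA
    hc.hasMFDerivAt

theorem exists_isTangentAt (hA : A.TransversalToInputs S) (v : A.carrier) :
    ∃ τ : Fin m → ℝ, A.IsTangentAt v.1 (S.controlledVector v.1 τ) := by
  obtain ⟨U, hU, hv, μ, hμ⟩ := A.D_regular v.1.proj
  exact ⟨_, A.isTangentAt_cramerFeedback S hA hU hμ hv v.2⟩

/-- Convex selection by partition of unity: the admissible values are the singleton `{û v}` on `𝒜`
and everything off `𝒜`. Local smooth selections are the Cramer feedbacks, which equal `û` on `𝒜`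
because the tangent control value is unique. -/
theorem exists_isSmoothExtension [T2Space Q] [SecondCountableTopology Q]
    (hA : A.TransversalToInputs S) {û : A.carrier → Fin m → ℝ}
    (hû : ∀ v : A.carrier, A.IsTangentAt v.1 (S.controlledVector v.1 (û v))) :
    ∃ u, A.IsSmoothExtension û u := by
  obtain ⟨u, hu⟩ := exists_contMDiffMap_forall_mem_convex_of_local 𝓘(ℝ, E).tangent (n := ⊤)
    (M := TangentBundle 𝓘(ℝ, E) Q)
    (t := fun v ↦ {τ : Fin m → ℝ | ∀ h : v ∈ A.carrier, τ = û ⟨v, h⟩})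
    (fun v ↦ by
      by_cases h : v ∈ A.carrier
      · simp [h]
      · simp [h, convex_univ])
    (fun v ↦ by
      obtain ⟨U, hU, hv, μ, hμ⟩ := A.D_regular v.proj
      refine ⟨TotalSpace.proj ⁻¹' U, (hU.preimage (FiberBundle.continuous_proj E
        (TangentSpace 𝓘(ℝ, E)))).mem_nhds hv, A.cramerFeedback S μ, fun z hz ↦
        (A.contMDiffAt_cramerFeedback S hA hU hμ hz).contMDiffWithinAt, fun z hz h ↦ ?_⟩
      exact A.eq_of_isTangentAt S hA (A.isTangentAt_cramerFeedback S hA hU hμ hz h) (hû ⟨z, h⟩))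
  exact ⟨u, u.contMDiff, fun v ↦ hu v.1 v.2⟩

/-- A smooth feedback whose closed-loop field is tangent to `𝒜` leaves `𝒜` invariant. -/
theorem flowInvariant_of_isTangentAt (hA : A.TransversalToInputs S)
    {u : TangentBundle 𝓘(ℝ, E) Q → Fin m → ℝ}
    (hu : ContMDiff 𝓘(ℝ, E).tangent 𝓘(ℝ, Fin m → ℝ) ∞ u)
    (hT : ∀ v ∈ A.carrier, A.IsTangentAt v (S.closedLoopField u v)) :
    A.FlowInvariant (S.closedLoopField u) := by
  intro J c hJ hJc hc t₀ ht₀ hct₀ t ht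
  have hopen : ∀ s ∈ J, c s ∈ A.carrier → ∀ᶠ r in 𝓝 s, c r ∈ A.carrier := by
    intro s hs hcs
    obtain ⟨U, hU, hsU, μ, hμ⟩ := A.D_regular (c s).proj
    -- The comparison curve stays in `𝒜`, where `u` and the Cramer feedback coincide; it is thus an
    -- integral curve for `u` as well, and ODE uniqueness identifies it with `c` near `s`.
    obtain ⟨c', hc's, hc', hc'A⟩ := A.exists_integralCurve_cramerFeedback S hA hU hμ hsU hcs s
    have hc'U : ∀ᶠ r in 𝓝 s, (c' r).proj ∈ U :=
      ((FiberBundle.continuous_proj E (TangentSpace 𝓘(ℝ, E))).continuousAt.comp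
        hc'.continuousAt).preimage_mem_nhds 
          (hU.mem_nhds (by rw [Function.comp_apply, hc's]; exact hsU))
    have hc'' : IsMIntegralCurveAt c' (S.closedLoopField u) s := by
      filter_upwards [hc', hc'A, hc'U] with r hr hrA hrU
      have e : u (c' r) = A.cramerFeedback S μ (c' r) :=
        A.eq_of_isTangentAt S hA (hT _ hrA) (A.isTangentAt_cramerFeedback S hA hU hμ hrU hrA)
      rw [MechanicalControlSystem.closedLoopField, e]
      exact hr
    have heq := isMIntegralCurveAt_eventuallyEq_of_contMDiffAt_boundaryless
      ((S.contMDiffAt_closedLoopField hu.contMDiffAt).of_le (by norm_cast))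
      (hc.isMIntegralCurveAt (hJ.mem_nhds hs)) hc'' hc's.symm
    filter_upwards [heq, hc'A] with r hr hrA
    rwa [hr]
  -- The times spent in `𝒜` form a nonempty set, open by `hopen` and relatively closed in the
  -- connected set `J` because `𝒜` is closed.
  have hsub : J ⊆ {s | s ∈ J ∧ c s ∈ A.carrier} := by
    refine hJc.isPreconnected.subset_of_closure_inter_subset ?_ ⟨t₀, ht₀, ht₀, hct₀⟩ ?_
    · rw [isOpen_iff_mem_nhds]
      rintro s ⟨hs, hcs⟩
      exact Filter.Eventually.and (hJ.mem_nhds hs) (hopen s hs hcs)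
    · rintro s ⟨hs, hsJ⟩
      refine ⟨hsJ, ?_⟩
      have hcont : ContinuousAt c s := (hc.isMIntegralCurveAt (hJ.mem_nhds hsJ)).continuousAt
      have hmem := hcont.continuousWithinAt.mem_closure_image hs
      refine A.isClosed_carrier.closure_subset_iff.2 ?_ hmem
      rintro _ ⟨r, hr, rfl⟩
      exact hr.2
  exact (hsub ht).2

end AffineDistribution

end

/-! ### The virtual constraint theorem. -/

theorem mainTheorem1
    {E : Type*} [NormedAddCommGroup E] [NormedSpace ℝ E] [FiniteDimensional ℝ E]
    {Q : Type*} [TopologicalSpace Q] [T2Space Q] [SecondCountableTopology Q]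
    [ChartedSpace E Q] [IsManifold 𝓘(ℝ, E) ∞ Q] {m : ℕ}
    (S : MechanicalControlSystem E Q m) (A : AffineDistribution E Q m)
    (hA : A.TransversalToInputs S) :
    ∃ û : A.carrier → Fin m → ℝ,
      -- `û` makes `𝒜` a virtual affine nonholonomic constraint, and it is the only one
      (A.IsVirtualConstraintFor S û ∧ ∀ û', A.IsVirtualConstraintFor S û' → û' = û) ∧
      -- even among control functions without any regularity
      (∀ û' : A.carrier → Fin m → ℝ, (∀ v, A.HasSolutionThrough S û' v) → û' = û) ∧
      -- `û` solves the linear system `P(v) û(v) = b(v)`, whose matrix is invertible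
      (∀ (U : Set Q) (μ : Fin m → OneForm E Q), IsOpen U → IsAnnihilatorOn A.D U μ →
        (∀ q ∈ U, IsUnit (AffineDistribution.controlMatrix S μ q)) ∧
        ∀ v : A.carrier, v.1.proj ∈ U →
          (AffineDistribution.controlMatrix S μ v.1.proj).mulVec (û v) =
            A.controlRhs S μ v.1) ∧
      -- the closed-loop vector field is smooth and tangent to `𝒜`, and its integral curves are
      -- the velocity curves of the closed-loop mechanical control system
      ∀ u, A.IsSmoothExtension û u →
        ContMDiff 𝓘(ℝ, E).tangent 𝓘(ℝ, E).tangent.tangent ∞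
          (fun v ↦ (⟨v, S.closedLoopField u v⟩ :
            TangentBundle 𝓘(ℝ, E).tangent (TangentBundle 𝓘(ℝ, E) Q))) ∧
        (∀ v : A.carrier, A.IsTangentAt v.1 (S.closedLoopField u v.1)) ∧
        ∀ (J : Set ℝ) (c : ℝ → TangentBundle 𝓘(ℝ, E) Q), IsOpen J →
          (IsMIntegralCurveOn c (S.closedLoopField u) J ↔
            ∃ q : ℝ → Q, S.IsTrajectoryOn u q J ∧ ∀ t ∈ J, c t = ⟨q t, velocity q t⟩) := by
  choose û hû using A.exists_isTangentAt S hA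
  have hext : ∀ u, A.IsSmoothExtension û u → ∀ v ∈ A.carrier,
      A.IsTangentAt v (S.closedLoopField u v) := fun u hu v hv ↦ by
    rw [MechanicalControlSystem.closedLoopField, hu.eq_on ⟨v, hv⟩]
    exact hû ⟨v, hv⟩
  refine ⟨û, ⟨⟨A.exists_isSmoothExtension S hA hû, fun u hu ↦
    A.flowInvariant_of_isTangentAt S hA hu.smooth (hext u hu)⟩, fun û' hû' ↦ ?_⟩,
    fun û' hû' ↦ ?_, fun U μ hU hμ ↦ ⟨fun q hq ↦ A.isUnit_controlMatrix S hA hμ hq,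
    fun v hv ↦ A.mulVec_eq_controlRhs_of_isTangentAt S hU hμ hv (hû v)⟩, fun u hu ↦ ⟨?_, ?_, ?_⟩⟩
  · obtain ⟨⟨u, hu⟩, hinv⟩ := hû'
    funext v
    refine A.eq_of_isTangentAt S hA ?_ (hû v)
    -- Invariance alone asserts no existence of curves: a local integral curve of the smooth closed
    -- loop is produced first, then invariance keeps it in `𝒜` and makes its velocity tangent.
    obtain ⟨c, hcv, hc⟩ := exists_isMIntegralCurveAt_of_contMDiffAt_boundaryless 0
      ((S.contMDiffAt_closedLoopField (hu.smooth.contMDiffAt (x := v.1))).of_le (by norm_cast))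
    obtain ⟨ε, hε, hcε⟩ := isMIntegralCurveAt_iff'.1 hc
    have hmem := hinv u hu (Metric.ball 0 ε) c Metric.isOpen_ball
      (convex_ball (0 : ℝ) ε).ordConnected hcε 0 (Metric.mem_ball_self hε) (hcv ▸ v.2)
    have h := A.isTangentAt_of_curve hcv (W := S.closedLoopField u)
      (Filter.eventually_of_mem (Metric.ball_mem_nhds 0 hε) hmem) hc.hasMFDerivAt
    rwa [MechanicalControlSystem.closedLoopField, hu.eq_on v] at h
  · funext v
    refine A.eq_of_isTangentAt S hA ?_ (hû v)
    obtain ⟨c, ε, hε, hcv, hc⟩ := hû' v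
    have h0 : (0 : ℝ) ∈ Ioo (-ε) ε := ⟨neg_lt_zero.2 hε, hε⟩
    obtain ⟨h, hd⟩ := hc 0 h0
    classical
    -- The control is set to `0` off `𝒜` only to have a field on all of `TQ`; the conclusion
    -- concerns its value at `c 0`, which lies in `𝒜`.
    have := A.isTangentAt_of_curve hcv
      (W := fun z ↦ S.controlledVector z (if hz : z ∈ A.carrier then û' ⟨z, hz⟩ else 0))
      (Filter.eventually_of_mem (isOpen_Ioo.mem_nhds h0) fun t ht ↦ (hc t ht).1)
      (by simpa only [dif_pos h] using hd)
    simpa only [dif_pos v.2] using this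
  · exact fun v ↦ S.contMDiffAt_closedLoopField hu.smooth.contMDiffAt
  · exact fun v ↦ hext u hu v.1 v.2
  · exact fun J c hJ ↦ S.isMIntegralCurveOn_closedLoopField_iff u hJ c
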